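/- Let $d \ge 3$. Conventions. $SL(2,\mathbb{C})$ is the group of spin isometries of hyperbolic space $\mathbb{H}^3$ (the double cover of $\mathrm{Isom}^+\mathbb{H}^3 = PSL(2,\mathbb{C})$), and a spin frame is a lift of a right-handed orthonormal frame of $\mathbb{H}^3$ to the double cover $\mathrm{Spin} \cong SL(2,\mathbb{C})$ of the frame bundle. A spin decoration on a horosphere is a pair $(W^{in}, W^{out})$ of continuous lifts to spin frames of the frame fields $(N^{in}, V, N^{in}\times V)$ and $(N^{out}, V, N^{out} \times V)$, where $V$ is a parallel unit tangent vector field, $N^{out}$ and $N^{in} = -N^{out}$ are the unit normals towards and away from the centre, and $W^{in}$ is obtained from $W^{out}$ by rotation through $\pi$ about $V$. The lambda length from one spin-decorated horosphere to another with a different centre is $\lambda = \exp(\frac12(\rho + i\theta))$, where translation through the signed distance $\rho$ along the oriented geodesic from the first centre to the second, followed by rotation through the angle $\theta$ (mod $4\pi$) about it, takes the first inward spin frame on this geodesic to the second outward spin frame on it. A nonzero spinor $\kappa = (\xi,\eta) \in \mathbb{C}^2$ corresponds to the horosphere in the upper half space model that is centred at $\xi/\eta$ and has Euclidean diameter $|\eta|^{-2}$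 (height $|\xi|^2$ if $\eta = 0$), with the spin decoration whose outward spin frames are the elements of $SL(2,\mathbb{C})$ that map $(1,0)$ to $\kappa$. Regard $\mathbb{H}^2$ as the half plane $y=0$ in the upper half space $\{(x,y,z) : z>0\}$, with boundary $\mathbb{R}\cup\{\infty\}$. An ideal $d$-gon is a sequence $p_1,\dots,p_d$ of distinct points of $\mathbb{R}\cup\{\infty\}$ in cyclic order for the decreasing orientation of $\mathbb{R}$. A planar spin decoration on a horocycle of $\mathbb{H}^2$ is a spin decoration on the horosphere of $\mathbb{H}^3$ extending it whose field $V$ is the unit vector in the positive $y$-direction along $\mathbb{H}^2$. A spin-coherent ideal $d$-gon is an ideal $d$-gon with a horocycle at each vertex and a planar spin decoration on each horocycle, such that the lambda lengths satisfy $\lambda_{ij}>0$ for $i<j$ and $\lambda_{ij}<0$ for $i>j$. Its spin isometry class is its orbit under $SL(2,\mathbb{R})$. The isometry class of an ideal $d$-gon decorated with a horocycle at each vertex consists of its images under isometries of $\mathbb{H}^2$ (as labelled polygons). The set of these classes is Penner's decorated Teichmüller space of a disc with $d$ boundary punctures. Then: 1. Sending a $2\times d$ real matrix, all of whose $2\times2$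 submatrices (columns $i<j$) have positive determinant, to the spin-decorated horospheres that correspond to its columns is an $SL(2,\mathbb{R})$-equivariant bijection onto the set of spin-coherent ideal $d$-gons. Hence it induces a bijection from the set of $SL(2,\mathbb{R})$-orbits of such matrices to the set of spin isometry classes of spin-coherent ideal $d$-gons. 2. Forgetting the spin decorations induces a bijection from the set of spin isometry classes of spin-coherent ideal $d$-gons to the set of isometry classes of ideal $d$-gons in $\mathbb{H}^2$ decorated with a horocycle at each vertex. 3. Consequently, sending a matrix to the decorated ideal $d$-gon underlying the spin-coherent ideal $d$-gon of its columns induces a bijection from $$SL(2,\mathbb{R}) \backslash \{\text{real } 2\times d \text{ matrices all of whose } 2\times 2 \text{ submatrices have positive determinant}\}$$ to the decorated Teichmüller space of a disc with $d$ boundary punctures. -/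

import Mathlib

open scoped ComplexOrder

noncomputable section

namespace SpinPolygon

/-! ### Hyperbolic 3-space: the hyperboloid model in Hermitian matrices

The point `(T, X, Y, Z)` of Minkowski space is written as the Hermitian matrix
`T • 1 + X • eX + Y • eY + Z • eZ`, so that the determinant is the quadratic form
`T ^ 2 - X ^ 2 - Y ^ 2 - Z ^ 2`. -/

/-- Complex `2 × 2` matrices. -/
abbrev Mat2 : Type := Matrix (Fin 2) (Fin 2) ℂ

/-- The group of spin isometries of hyperbolic 3-space. -/
abbrev SL2C : Type := Matrix.SpecialLinearGroup (Fin 2) ℂ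

/-- The group of spin isometries that preserve the hyperbolic plane. -/
abbrev SL2R : Type := Matrix.SpecialLinearGroup (Fin 2) ℝ

/-- The spin isometry of hyperbolic 3-space given by a real matrix. -/
def toSL2C : SL2R →* SL2C := Matrix.SpecialLinearGroup.map (algebraMap ℝ ℂ)

/-- The Minkowski inner product of two Hermitian matrices: the polarisation of the determinant. -/
@[irreducible]
def mink (X Y : Mat2) : ℝ := ((X * Y.adjugate).trace).re / 2

theorem mink_def (X Y : Mat2) : mink X Y = ((X * Y.adjugate).trace).re / 2 := by
  rw [mink]

/-- The linear action of a spin isometry on Hermitian matrices. -/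
def linAct (A : SL2C) (X : Mat2) : Mat2 := (A : Mat2) * X * (A : Mat2).conjTranspose

/-- Hyperbolic 3-space: positive definite Hermitian matrices of determinant 1, that is, the sheet
`T > 0` of the hyperboloid. -/
abbrev H3 : Type := {S : Mat2 // S.PosDef ∧ S.det = 1}

theorem linAct_one (X : Mat2) : linAct 1 X = X := by
  simp [linAct]

theorem linAct_mul (A B : SL2C) (X : Mat2) : linAct (A * B) X = linAct A (linAct B X) := by
  simp [linAct, Matrix.mul_assoc, Matrix.conjTranspose_mul]

theorem linAct_mem (A : SL2C) (S : H3) :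
    (linAct A S.1).PosDef ∧ (linAct A S.1).det = 1 := by
  refine ⟨?_, ?_⟩
  · have hA : IsUnit (A : Mat2) := by
      rw [Matrix.isUnit_iff_isUnit_det]; simp
    exact S.2.1.mul_mul_conjTranspose_same (Matrix.vecMul_injective_of_isUnit hA)
  · simp [linAct, Matrix.det_mul, Matrix.det_conjTranspose, S.2.2]

/-- Spin isometries act on hyperbolic 3-space by orientation-preserving isometries. -/
instance : MulAction SL2C H3 where
  smul A S := ⟨linAct A S.1, linAct_mem A S⟩
  one_smul S := Subtype.ext (linAct_one S.1)
  mul_smul A B S := Subtype.ext (linAct_mul A B S.1)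

theorem coe_smul (A : SL2C) (S : H3) : ((A • S : H3) : Mat2) = linAct A S.1 := rfl

theorem mink_linAct (A : SL2C) (X Y : Mat2) : mink (linAct A X) (linAct A Y) = mink X Y := by
  have h1 : (A : Mat2).adjugate * (A : Mat2) = 1 := by simp [Matrix.adjugate_mul]
  have h2 : (A : Mat2).conjTranspose * (A : Mat2).conjTranspose.adjugate = 1 := by
    simp [Matrix.mul_adjugate, Matrix.det_conjTranspose]
  have h3 : linAct A X * (linAct A Y).adjugate
      = (A : Mat2) * (X * Y.adjugate * (A : Mat2).adjugate) := by
    simp only [linAct, Matrix.adjugate_mul_distrib]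
    calc (A : Mat2) * X * (A : Mat2).conjTranspose *
          ((A : Mat2).conjTranspose.adjugate * (Y.adjugate * (A : Mat2).adjugate))
        = (A : Mat2) * X * ((A : Mat2).conjTranspose * (A : Mat2).conjTranspose.adjugate) *
            (Y.adjugate * (A : Mat2).adjugate) := by simp only [Matrix.mul_assoc]
      _ = (A : Mat2) * (X * Y.adjugate * (A : Mat2).adjugate) := by
          rw [h2]; simp only [Matrix.mul_assoc, Matrix.one_mul]
  have h4 : (linAct A X * (linAct A Y).adjugate).trace = (X * Y.adjugate).trace := by
    rw [h3, Matrix.trace_mul_comm, Matrix.mul_assoc, h1, Matrix.mul_one]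
  simp only [mink_def, h4]

/-! ### Frames and spin frames -/

/-- The base point `(0, 0, 1)` of the upper half space model. -/
def basePoint : H3 := ⟨1, Matrix.PosDef.one, Matrix.det_one⟩

/-- The unit tangent vector at the base point in the `x`-direction of the upper half space model.
Together, `eX, eY, eZ` form a right-handed frame. -/
def eX : Mat2 := !![0, 1; 1, 0]

/-- The unit tangent vector at the base point in the `y`-direction. -/
def eY : Mat2 := !![0, Complex.I; -Complex.I, 0]

/-- The unit tangent vector at the base point in the `z`-direction. -/
def eZ : Mat2 := !![1, 0; 0, -1]

/-- Spin frames. Orientation-preserving isometries act simply transitively on the right-handed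
orthonormal frames of hyperbolic 3-space, so that the frame bundle is `PSL(2, ℂ)`, through
`A ↦ A • (eZ, eY, -eX)`, and its double cover, the bundle of spin frames, is `SL(2, ℂ)`. The maps
`basepoint` and `frame` below are the projection to the frame bundle. Spin isometries act on spin
frames by left multiplication. -/
abbrev SpinFrame : Type := SL2C

/-- The point of hyperbolic 3-space at which a spin frame lies. -/
def SpinFrame.basepoint (W : SpinFrame) : H3 := W • basePoint

/-- The frame `(f₁, f₂, f₃)` that a spin frame lifts. -/
def SpinFrame.frame (W : SpinFrame) : Fin 3 → Mat2 :=
  ![linAct W eZ, linAct W eY, linAct W (-eX)]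

/-- Right multiplication by this matrix rotates each spin frame through the (right-handed) angle
`θ` about the second vector of its frame. -/
def rotSecond (θ : ℝ) : SL2C :=
  ⟨!![(Real.cos (θ / 2) : ℂ), -(Real.sin (θ / 2) : ℂ);
      (Real.sin (θ / 2) : ℂ), (Real.cos (θ / 2) : ℂ)], by
    rw [Matrix.det_fin_two_of]
    have h := Real.cos_sq_add_sin_sq (θ / 2)
    have h' : ((Real.cos (θ / 2) : ℂ)) ^ 2 + (Real.sin (θ / 2) : ℂ) ^ 2 = 1 := by exact_mod_cast h
    linear_combination h'⟩

/-- Right multiplication by this matrix translates each spin frame through the signed distance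
`d.re` along the geodesic directed by the first vector of its frame, and then rotates it through
the (right-handed) angle `d.im` about that geodesic. -/
def screwFirst (d : ℂ) : SL2C :=
  ⟨!![Complex.exp (d / 2), 0; 0, Complex.exp (-d / 2)], by
    rw [Matrix.det_fin_two_of, mul_zero, sub_zero, ← Complex.exp_add]
    rw [show d / 2 + -d / 2 = 0 by ring, Complex.exp_zero]⟩

/-- `d` is the complex distance from the spin frame `W₁` to the spin frame `W₂` (both are then
adapted to a common oriented geodesic). It is defined modulo `4πi`. -/
def IsComplexDistance (W₁ W₂ : SpinFrame) (d : ℂ) : Prop := W₂ = W₁ * screwFirst d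

/-! ### Horospheres and spin decorations -/

/-- The positive light cone: nonzero lightlike vectors that point to the future. -/
def lightCone : Set Mat2 := {n | n.IsHermitian ∧ n.det = 0 ∧ 0 < n.trace.re}

/-- The horosphere of a point `n` of the positive light cone. Its centre is the ray of `n`, and
this is a bijection between the positive light cone and the set of all horospheres. -/
def horosphere (n : Mat2) : Set H3 := {S | mink S.1 n = 1}

/-- `V` is a parallel field of unit tangent vectors on the horosphere of `n`: it is invariant under
the parabolic isometries that preserve the horosphere. -/
def IsParallelUnitField (n : Mat2) (V : horosphere n → Mat2) : Prop :=
  (∀ S, (V S).IsHermitian ∧ mink (V S) S.1.1 = 0 ∧ mink (V S) n = 0 ∧ mink (V S) (V S) = -1) ∧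
  ∀ A : SL2C, ((A : Mat2).trace = 2 ∨ (A : Mat2).trace = -2) →
    (∀ S : H3, A • S ∈ horosphere n ↔ S ∈ horosphere n) →
    ∀ S S' : horosphere n, (S' : H3) = A • (S : H3) → V S' = linAct A (V S)

/-- `W` is a continuous lift to spin frames of the outward frame field `(N, V, N × V)` on the
horosphere of `n`, where `N` is the unit normal field towards the centre, `N S = n - S`. (The
frames are right-handed, so the first two vectors determine the third.) -/
def IsOutwardSpinDecoration (n : Mat2) (V : horosphere n → Mat2) (W : horosphere n → SpinFrame) :
    Prop :=
  Continuous W ∧ ∀ S, SpinFrame.basepoint (W S) = S.1 ∧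
    SpinFrame.frame (W S) 0 = n - S.1.1 ∧ SpinFrame.frame (W S) 1 = V S

/-- `W` is a continuous lift to spin frames of the inward frame field `(N, V, N × V)` on the
horosphere of `n`, where `N` is the unit normal field away from the centre, `N S = S - n`. -/
def IsInwardSpinDecoration (n : Mat2) (V : horosphere n → Mat2) (W : horosphere n → SpinFrame) :
    Prop :=
  Continuous W ∧ ∀ S, SpinFrame.basepoint (W S) = S.1 ∧
    SpinFrame.frame (W S) 0 = S.1.1 - n ∧ SpinFrame.frame (W S) 1 = V S

/-- The pair `(Win, Wout)` is a spin decoration on the horosphere of `n`: the two lift the inward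
and outward frame fields of one parallel unit field `V`, and `Win` is obtained from `Wout` by
rotation through `π` about `V`. -/
def IsSpinDecoration (n : Mat2) (Win Wout : horosphere n → SpinFrame) : Prop :=
  (∃ V, IsParallelUnitField n V ∧ IsInwardSpinDecoration n V Win ∧
    IsOutwardSpinDecoration n V Wout) ∧
  ∀ S, Win S = Wout S * rotSecond Real.pi

/-- A spin-decorated horosphere: the horosphere of a point `normal` of the positive light cone, with
a spin decoration. -/
structure SpinDecoratedHorosphere where
  normal : Mat2
  normal_mem : normal ∈ lightCone
  inward : horosphere normal → SpinFrame
  outward : horosphere normal → SpinFrame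
  isSpinDecoration : IsSpinDecoration normal inward outward

/-- The spin isometry `A` maps the spin-decorated horosphere `D` to `D'`. -/
def Maps (A : SL2C) (D D' : SpinDecoratedHorosphere) : Prop :=
  D'.normal = linAct A D.normal ∧
  ∀ (S : horosphere D.normal) (S' : horosphere D'.normal), (S' : H3) = A • (S : H3) →
    D'.inward S' = A * D.inward S ∧ D'.outward S' = A * D.outward S

/-- `S` lies on the geodesic between the ideal points given by the rays of `n₁` and `n₂`. -/
def OnGeodesic (n₁ n₂ : Mat2) (S : H3) : Prop :=
  ∃ a b : ℝ, 0 < a ∧ 0 < b ∧ S.1 = a • n₁ + b • n₂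

/-- `d` is the complex distance from `D₁` to `D₂`: the one from the inward spin frame of `D₁` at
`q₁` to the outward spin frame of `D₂` at `q₂`, where `q₁` and `q₂` are the points where the
geodesic between the centres meets the two horospheres. There is none if the centres agree. -/
def IsHorosphereDistance (D₁ D₂ : SpinDecoratedHorosphere) (d : ℂ) : Prop :=
  ∃ (q₁ : horosphere D₁.normal) (q₂ : horosphere D₂.normal),
    OnGeodesic D₁.normal D₂.normal q₁ ∧ OnGeodesic D₁.normal D₂.normal q₂ ∧
    IsComplexDistance (D₁.inward q₁) (D₂.outward q₂) d

open Classical in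
/-- The complex lambda length `exp (d / 2)` from `D₁` to `D₂`, and `0` if the centres agree. -/
def lambdaLength (D₁ D₂ : SpinDecoratedHorosphere) : ℂ :=
  if h : ∃ d, IsHorosphereDistance D₁ D₂ d then Complex.exp (h.choose / 2) else 0

/-- The spin-decorated horosphere that corresponds to the spinor `κ`: the horosphere is that of the
point `2 κ κ*` of the light cone (so its centre is `κ 0 / κ 1`), and its outward spin frames are
the elements of `SL(2, ℂ)` that map the spinor `(1, 0)` to `κ`. -/
def CorrespondsTo (D : SpinDecoratedHorosphere) (κ : Fin 2 → ℂ) : Prop :=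
  D.normal = (2 : ℂ) • Matrix.vecMulVec κ (star κ) ∧
  ∀ S, (D.outward S : Mat2).mulVec ![1, 0] = κ

/-! ### The hyperbolic plane, its ideal polygons and horocycles -/

/-- The Hermitian matrix of a point of the hyperbolic plane in hyperbolic 3-space. The point `(z, t)` of the upper
half space model is the Hermitian matrix with rows `(‖z‖ ^ 2 + t ^ 2, z) / t` and
`(conj z, 1) / t`; the point `x + i y` of the upper half plane is the point `(x, y)` of the upper
half space. -/
def planeMatrix (z : UpperHalfPlane) : Mat2 :=
  ((z.im⁻¹ : ℝ) : ℂ) • !![((z.re ^ 2 + z.im ^ 2 : ℝ) : ℂ), (z.re : ℂ); (z.re : ℂ), 1]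

theorem planeMatrix_mem (z : UpperHalfPlane) :
    (planeMatrix z).PosDef ∧ (planeMatrix z).det = 1 := by
  have hy : 0 < z.im := z.im_pos
  have hyc : (z.im : ℂ) ≠ 0 := by exact_mod_cast hy.ne'
  refine ⟨?_, ?_⟩
  · have key : planeMatrix z = ((z.im⁻¹ : ℝ) : ℂ) •
        ((!![(z.im : ℂ), (z.re : ℂ); 0, 1] : Mat2) * 1 *
          (!![(z.im : ℂ), (z.re : ℂ); 0, 1] : Mat2).conjTranspose) := by
      ext i j
      rw [Matrix.mul_one]
      simp only [planeMatrix, Matrix.smul_apply]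
      congr 1
      rw [Matrix.mul_apply, Fin.sum_univ_two, Matrix.conjTranspose_apply,
        Matrix.conjTranspose_apply]
      fin_cases i <;> fin_cases j <;> simp
      ring
    have hB : IsUnit (!![(z.im : ℂ), (z.re : ℂ); 0, 1] : Mat2) := by
      rw [Matrix.isUnit_iff_isUnit_det, Matrix.det_fin_two_of]
      simpa using hy.ne'
    rw [key]
    refine Matrix.PosDef.smul ?_ ?_
    · exact Matrix.PosDef.one.mul_mul_conjTranspose_same (Matrix.vecMul_injective_of_isUnit hB)
    · rw [Complex.zero_lt_real]; exact inv_pos.mpr hy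
  · rw [planeMatrix, Matrix.det_smul, Matrix.det_fin_two_of]
    push_cast
    simp only [Fintype.card_fin]
    field_simp
    ring

/-- The inclusion of the hyperbolic plane in hyperbolic 3-space. -/
def plane (z : UpperHalfPlane) : H3 := ⟨planeMatrix z, planeMatrix_mem z⟩

/-- The horocycle in the upper half plane centred at `p ∈ ℝ ∪ {∞}`: the horizontal line at height
`r` if `p = ∞`, and the circle of Euclidean diameter `r` tangent to the real line at `p` if not. -/
def horocycle (p : OnePoint ℝ) (r : ℝ) : Set UpperHalfPlane :=
  OnePoint.rec {z | z.im = r} (fun x : ℝ => {z | (z.re - x) ^ 2 + z.im ^ 2 = r * z.im}) p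

/-- `c` is a horocycle centred at `p`. -/
def IsHorocycle (p : OnePoint ℝ) (c : Set UpperHalfPlane) : Prop :=
  ∃ r : ℝ, 0 < r ∧ c = horocycle p r

/-- Points of `ℝ ∪ {∞}` as elements of the linear order in which `∞` is the largest. -/
def height (p : OnePoint ℝ) : WithTop ℝ := OnePoint.rec ⊤ (fun x : ℝ => (x : WithTop ℝ)) p

/-- `a, b, c` are distinct and in cyclic order on `ℝ ∪ {∞}`, oriented in the negative direction. -/
def CyclicTriple (a b c : OnePoint ℝ) : Prop :=
  (height b < height a ∧ height c < height b) ∨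
  (height c < height b ∧ height a < height c) ∨
  (height a < height c ∧ height b < height a)

/-- `p` is a sequence of distinct points in (cyclic) order around `ℝ ∪ {∞}`, oriented in the
negative direction. -/
def InOrder {d : ℕ} (p : Fin d → OnePoint ℝ) : Prop :=
  Function.Injective p ∧ ∀ i j k : Fin d, i < j → j < k → CyclicTriple (p i) (p j) (p k)

/-- An ideal `d`-gon in the hyperbolic plane, decorated with a horocycle at each vertex. -/
structure DecoratedIdealGon (d : ℕ) where
  vertex : Fin d → OnePoint ℝ
  inOrder : InOrder vertex
  horocycle : Fin d → Set UpperHalfPlane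
  isHorocycle : ∀ i, IsHorocycle (vertex i) (horocycle i)

/-- The decoration of `D` is a planar spin decoration on the horocycle `c`: the horosphere of `D` is
the one that extends `c`, and the decoration is in the direction `i`, which is the direction of the
`y`-axis in the upper half space model. (The north pole lies in the hyperbolic plane if the centre
is in `ℝ`; at each point of the hyperbolic plane the unit vector in the `y`-direction is `eY`.) -/
def IsPlanarSpinDecoration (c : Set UpperHalfPlane) (D : SpinDecoratedHorosphere) : Prop :=
  plane ⁻¹' horosphere D.normal = c ∧
  ∀ (z : UpperHalfPlane) (hz : plane z ∈ horosphere D.normal),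
    SpinFrame.frame (D.inward ⟨plane z, hz⟩) 1 = eY ∧
    SpinFrame.frame (D.outward ⟨plane z, hz⟩) 1 = eY

/-- A spin-coherent ideal `d`-gon: an ideal `d`-gon with horocycles and planar spin decorations on
them, with lambda lengths `λ i j > 0` for `i < j` and `λ i j < 0` for `i > j`. -/
structure SpinCoherentGon (d : ℕ) extends DecoratedIdealGon d where
  decoration : Fin d → SpinDecoratedHorosphere
  planar : ∀ i, IsPlanarSpinDecoration (horocycle i) (decoration i)
  coherent_lt : ∀ i j, i < j → ∃ r : ℝ, 0 < r ∧ lambdaLength (decoration i) (decoration j) = r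
  coherent_gt : ∀ i j, j < i → ∃ r : ℝ, r < 0 ∧ lambdaLength (decoration i) (decoration j) = r

/-- Real `2 × d` matrices in which all `2 × 2` submatrices have positive determinant. -/
abbrev PositiveMatrix (d : ℕ) : Type :=
  {M : Matrix (Fin 2) (Fin d) ℝ // ∀ i j, i < j → 0 < (M.submatrix id ![i, j]).det}

/-- Column `i` of a real matrix, as a spinor. -/
def PositiveMatrix.spinor {d : ℕ} (M : PositiveMatrix d) (i : Fin d) : Fin 2 → ℂ :=
  fun k => (M.1 k i : ℂ)

/-! ### Isometry classes -/

/-- The isometry `φ` of the hyperbolic plane maps `P` to `Q`. (An isometry that maps a horocycle to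
a horocycle maps the centre to the centre.) -/
def MapsGon {d : ℕ} (φ : UpperHalfPlane ≃ᵢ UpperHalfPlane) (P Q : DecoratedIdealGon d) : Prop :=
  ∀ i, φ '' P.horocycle i = Q.horocycle i

/-- Two decorated ideal `d`-gons are equivalent if they are isometric. -/
instance isometrySetoid (d : ℕ) : Setoid (DecoratedIdealGon d) where
  r P Q := ∃ φ : UpperHalfPlane ≃ᵢ UpperHalfPlane, MapsGon φ P Q
  iseqv :=
    { refl := fun P => ⟨IsometryEquiv.refl _, fun i => by
        exact Set.image_id _⟩
      symm := by
        rintro P Q ⟨φ, h⟩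
        refine ⟨φ.symm, fun i => ?_⟩
        rw [← h i, ← Set.image_comp]
        simp
      trans := by
        rintro P Q R ⟨φ, h⟩ ⟨ψ, h'⟩
        refine ⟨φ.trans ψ, fun i => ?_⟩
        rw [← h' i, ← h i, ← Set.image_comp]
        rfl }

/-- Isometry classes of ideal `d`-gons in the hyperbolic plane, decorated with a horocycle at each
vertex: the decorated Teichmüller space of a disc with `d` boundary punctures. -/
abbrev IsometryClass (d : ℕ) : Type := Quotient (isometrySetoid d)

theorem Maps.one (D : SpinDecoratedHorosphere) : Maps 1 D D := by
  refine ⟨(linAct_one _).symm, fun S S' h => ?_⟩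
  have : S' = S := Subtype.ext (by simpa using h)
  subst this
  simp

theorem Maps.inv {A : SL2C} {D D' : SpinDecoratedHorosphere} (h : Maps A D D') :
    Maps A⁻¹ D' D := by
  refine ⟨?_, fun S' S hS => ?_⟩
  · rw [h.1, ← linAct_mul, inv_mul_cancel, linAct_one]
  · have h2 := h.2 S S' (by rw [hS, smul_inv_smul])
    rw [h2.1, h2.2, inv_mul_cancel_left, inv_mul_cancel_left]
    exact ⟨rfl, rfl⟩

theorem Maps.mul {A B : SL2C} {D D' D'' : SpinDecoratedHorosphere} (h : Maps A D D')
    (h' : Maps B D' D'') : Maps (B * A) D D'' := by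
  refine ⟨by rw [h'.1, h.1, linAct_mul], fun S S'' hS => ?_⟩
  have hm : A • (S : H3) ∈ horosphere D'.normal := by
    have hS1 : mink (S : H3).1 D.normal = 1 := S.2
    change mink (linAct A (S : H3).1) D'.normal = 1
    rw [h.1, mink_linAct, hS1]
  have h1 := h.2 S ⟨A • (S : H3), hm⟩ rfl
  have h2 := h'.2 ⟨A • (S : H3), hm⟩ S'' (by rw [hS, mul_smul])
  rw [h2.1, h2.2, h1.1, h1.2, mul_assoc, mul_assoc]
  exact ⟨rfl, rfl⟩

/-- The spin isometry `A` maps the spin-coherent ideal `d`-gon `X` to `Y`. -/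
def MapsSpinGon {d : ℕ} (A : SL2R) (X Y : SpinCoherentGon d) : Prop :=
  ∀ i, Maps (toSL2C A) (X.decoration i) (Y.decoration i)

/-- Two spin-coherent ideal `d`-gons are equivalent if they lie in one orbit of `SL(2, ℝ)`. -/
instance spinIsometrySetoid (d : ℕ) : Setoid (SpinCoherentGon d) where
  r X Y := ∃ A : SL2R, MapsSpinGon A X Y
  iseqv :=
    { refl := fun X => ⟨1, fun i => by rw [map_one]; exact Maps.one _⟩
      symm := by
        rintro X Y ⟨A, h⟩
        exact ⟨A⁻¹, fun i => by rw [map_inv]; exact (h i).inv⟩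
      trans := by
        rintro X Y Z ⟨A, h⟩ ⟨B, h'⟩
        exact ⟨B * A, fun i => by rw [map_mul]; exact (h i).mul (h' i)⟩ }

/-- Spin isometry classes of spin-coherent ideal `d`-gons. -/
abbrev SpinIsometryClass (d : ℕ) : Type := Quotient (spinIsometrySetoid d)

/-- Two matrices are equivalent if they lie in one orbit of the action of `SL(2, ℝ)` by left
multiplication. -/
instance orbitSetoid (d : ℕ) : Setoid (PositiveMatrix d) where
  r M N := ∃ A : SL2R, N.1 = A.1 * M.1
  iseqv :=
    { refl := fun M => ⟨1, by simp⟩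
      symm := by
        rintro M N ⟨A, h⟩
        refine ⟨A⁻¹, ?_⟩
        rw [h, ← Matrix.mul_assoc, ← Matrix.SpecialLinearGroup.coe_mul, inv_mul_cancel,
          Matrix.SpecialLinearGroup.coe_one, Matrix.one_mul]
      trans := by
        rintro M N P ⟨A, h⟩ ⟨B, h'⟩
        exact ⟨B * A, by rw [h', h, Matrix.SpecialLinearGroup.coe_mul, Matrix.mul_assoc]⟩ }

/-- The set of `SL(2, ℝ)`-orbits of real `2 × d` matrices in which all `2 × 2` submatrices have
positive determinant. -/
abbrev MatrixOrbit (d : ℕ) : Type := Quotient (orbitSetoid d)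

end SpinPolygon

end

/-!
A nonzero spinor `κ` is the same thing as a spin-decorated horosphere: the horosphere has light cone
normal `2 • κ κᴴ`, and the spinor is the first column of its outward spin frames. Under this
correspondence the lambda length of two decorations is the determinant of their spinors, and the
planar spin decorations are those of the real spinors, so a spin-coherent polygon is a real matrix
whose columns have positive determinants.

Forgetting the spin decorations only loses the sign of each spinor, and the cyclic order of the
vertices allows exactly one choice of signs, up to a common one, with positive determinants. For
injectivity, three points of a horocycle at suitable distances recover its light cone normal, so an
isometry of the plane preserves the squared determinants of the spinors and hence, by positivity,
the determinants; real spinors with the same determinants differ by an element of `SL(2, ℝ)`.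
-/

noncomputable section

namespace SpinPolygon

open scoped Matrix MatrixGroups

section Determinant

variable {R : Type*} [CommRing R]

/-- The determinant of the matrix with columns `v` and `w`: the invariant symplectic form on
spinors. -/
def spinorDet (v w : Fin 2 → R) : R := v 0 * w 1 - v 1 * w 0

theorem spinorDet_self (v : Fin 2 → R) : spinorDet v v = 0 := by
  rw [spinorDet, mul_comm, sub_self]

theorem spinorDet_swap (v w : Fin 2 → R) : spinorDet v w = -spinorDet w v := by
  simp only [spinorDet]; ring

theorem spinorDet_smul_left (c : R) (v w : Fin 2 → R) :
    spinorDet (c • v) w = c * spinorDet v w := by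
  simp only [spinorDet, Pi.smul_apply, smul_eq_mul]; ring

theorem spinorDet_smul_right (c : R) (v w : Fin 2 → R) :
    spinorDet v (c • w) = c * spinorDet v w := by
  simp only [spinorDet, Pi.smul_apply, smul_eq_mul]; ring

theorem spinorDet_neg_right (v w : Fin 2 → R) : spinorDet v (-w) = -spinorDet v w := by
  simp only [spinorDet, Pi.neg_apply]; ring

theorem specialLinearGroup_smul_eq_mulVec (A : SL(2, R)) (v : Fin 2 → R) : A • v = A.1 *ᵥ v :=
  rfl

theorem specialLinearGroup_smul_apply (A : SL(2, R)) (v : Fin 2 → R) (i : Fin 2) :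
    (A • v) i = A.1 i 0 * v 0 + A.1 i 1 * v 1 := by
  rw [specialLinearGroup_smul_eq_mulVec, Matrix.mulVec_fin_two]
  fin_cases i <;> rfl

theorem spinorDet_specialLinearGroup_smul (A : SL(2, R)) (v w : Fin 2 → R) :
    spinorDet (A • v) (A • w) = spinorDet v w := by
  have hA := A.det_coe
  rw [Matrix.det_fin_two] at hA
  simp only [spinorDet, specialLinearGroup_smul_apply]
  linear_combination (v 0 * w 1 - v 1 * w 0) * hA

theorem spinorDet_smul_eq_add (u v w : Fin 2 → R) :
    spinorDet u v • w = spinorDet w v • u + spinorDet u w • v := by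
  ext i
  fin_cases i <;> simp [spinorDet] <;> ring

/-- The element of `SL(2, R)` with columns `v` and `w`. -/
def ofColumns (v w : Fin 2 → R) (h : spinorDet v w = 1) : SL(2, R) :=
  ⟨!![v 0, w 0; v 1, w 1], by rw [Matrix.det_fin_two_of, ← h, spinorDet]; ring⟩

theorem ofColumns_smul {v w : Fin 2 → R} (h : spinorDet v w = 1) (x y : R) :
    ofColumns v w h • ![x, y] = x • v + y • w := by
  ext i
  rw [specialLinearGroup_smul_apply]
  fin_cases i <;> simp [ofColumns, mul_comm]

end Determinant

section Field

variable {F : Type*} [Field F]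

theorem exists_spinorDet_eq_one {v : Fin 2 → F} (hv : v ≠ 0) : ∃ w, spinorDet v w = 1 := by
  by_cases h0 : v 0 = 0
  · have h1 : v 1 ≠ 0 := fun h1 => hv (by ext i; fin_cases i <;> assumption)
    exact ⟨![-(v 1)⁻¹, 0], by simp [spinorDet, h1]⟩
  · exact ⟨![0, (v 0)⁻¹], by simp [spinorDet, h0]⟩

theorem exists_smul_eq_of_ne_zero {v : Fin 2 → F} (hv : v ≠ 0) :
    ∃ A : SL(2, F), A • ![1, 0] = v := by
  obtain ⟨w, h⟩ := exists_spinorDet_eq_one hv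
  exact ⟨ofColumns v w h, by rw [ofColumns_smul, one_smul, zero_smul, add_zero]⟩

theorem exists_eq_smul_of_spinorDet_eq_zero {v w : Fin 2 → F} (hv : v ≠ 0)
    (h : spinorDet v w = 0) : ∃ c : F, w = c • v := by
  obtain ⟨u, hu⟩ := exists_spinorDet_eq_one hv
  refine ⟨spinorDet w u, ?_⟩
  have plucker := spinorDet_smul_eq_add v u w
  rwa [hu, h, one_smul, zero_smul, add_zero] at plucker

theorem exists_eq_specialLinearGroup_smul {ι : Type*} {v w : ι → Fin 2 → F} {a b : ι}
    (hab : spinorDet (v a) (v b) ≠ 0)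
    (h : ∀ i j, spinorDet (w i) (w j) = spinorDet (v i) (v j)) :
    ∃ A : SL(2, F), ∀ i, w i = A • v i := by
  set D := spinorDet (v a) (v b)
  have unimodular (u : ι → Fin 2 → F) (hu : spinorDet (u a) (u b) = D) :
      spinorDet (u a) (D⁻¹ • u b) = 1 := by
    rw [spinorDet_smul_right, hu, inv_mul_cancel₀ hab]
  have coordinates (u : ι → Fin 2 → F) (hu : spinorDet (u a) (u b) = D) (i : ι) :
      ofColumns _ _ (unimodular u hu) •
        ![D⁻¹ * spinorDet (u i) (u b), spinorDet (u a) (u i)] = u i := by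
    have plucker := spinorDet_smul_eq_add (u a) (D⁻¹ • u b) (u i)
    rw [unimodular u hu, one_smul, spinorDet_smul_right] at plucker
    rw [ofColumns_smul, ← plucker]
  refine ⟨ofColumns _ _ (unimodular w (h a b)) * (ofColumns _ _ (unimodular v rfl))⁻¹, fun i => ?_⟩
  rw [mul_smul, inv_smul_eq_iff.mpr (coordinates v rfl i).symm, ← h, ← h, coordinates w (h a b)]

end Field

theorem spinorDet_comp {R S : Type*} [CommRing R] [CommRing S] (f : R →+* S) (v w : Fin 2 → R) :
    spinorDet (f ∘ v) (f ∘ w) = f (spinorDet v w) := by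
  simp only [spinorDet, Function.comp_apply, map_sub, map_mul]

theorem map_smul_comp {R S : Type*} [CommRing R] [CommRing S] (f : R →+* S) (A : SL(2, R))
    (v : Fin 2 → R) : Matrix.SpecialLinearGroup.map f A • (f ∘ v) = f ∘ (A • v) := by
  ext i
  simp only [Function.comp_apply, specialLinearGroup_smul_apply, map_add, map_mul]
  rfl

section Minkowski

theorem mink_apply (X Y : Mat2) :
    mink X Y = (X 0 0 * Y 1 1 - X 0 1 * Y 1 0 - X 1 0 * Y 0 1 + X 1 1 * Y 0 0).re / 2 := by
  rw [mink_def, Matrix.trace_fin_two, Matrix.adjugate_fin_two]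
  simp only [Matrix.mul_apply, Fin.sum_univ_two, Matrix.of_apply, Matrix.cons_val',
    Matrix.cons_val_zero, Matrix.cons_val_one, Matrix.cons_val_fin_one]
  ring_nf

theorem mink_comm (X Y : Mat2) : mink X Y = mink Y X := by
  rw [mink_apply, mink_apply]; ring_nf

theorem mink_add_left (X Y Z : Mat2) : mink (X + Y) Z = mink X Z + mink Y Z := by
  simp only [mink_def, add_mul, Matrix.trace_add, Complex.add_re, add_div]

theorem mink_sub_left (X Y Z : Mat2) : mink (X - Y) Z = mink X Z - mink Y Z := by
  simp only [mink_def, sub_mul, Matrix.trace_sub, Complex.sub_re, sub_div]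

theorem mink_smul_left (c : ℝ) (X Y : Mat2) : mink (c • X) Y = c * mink X Y := by
  simp only [mink_def, smul_mul_assoc, Matrix.trace_smul, Complex.smul_re, smul_eq_mul,
    mul_div_assoc]

theorem mink_add_right (X Y Z : Mat2) : mink X (Y + Z) = mink X Y + mink X Z := by
  simp only [mink_comm X, mink_add_left]

theorem mink_sub_right (X Y Z : Mat2) : mink X (Y - Z) = mink X Y - mink X Z := by
  simp only [mink_comm X, mink_sub_left]

theorem mink_smul_right (c : ℝ) (X Y : Mat2) : mink X (c • Y) = c * mink X Y := by
  simp only [mink_comm X, mink_smul_left]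

theorem mink_self (X : Mat2) : mink X X = X.det.re := by
  rw [mink_apply, Matrix.det_fin_two, div_eq_iff two_ne_zero, ← Complex.re_mul_ofReal]
  push_cast
  ring_nf

theorem linAct_add (A : SL2C) (X Y : Mat2) : linAct A (X + Y) = linAct A X + linAct A Y := by
  simp only [linAct, Matrix.mul_add, Matrix.add_mul]

theorem linAct_sub (A : SL2C) (X Y : Mat2) : linAct A (X - Y) = linAct A X - linAct A Y := by
  simp only [linAct, Matrix.mul_sub, Matrix.sub_mul]

theorem linAct_smul (A : SL2C) (c : ℝ) (X : Mat2) : linAct A (c • X) = c • linAct A X := by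
  simp only [linAct, Matrix.mul_smul, Matrix.smul_mul]

theorem linAct_neg (A : SL2C) (X : Mat2) : linAct A (-X) = -linAct A X := by
  simp only [linAct, Matrix.mul_neg, Matrix.neg_mul]

theorem linAct_neg_left (A : SL2C) (X : Mat2) : linAct (-A) X = linAct A X := by
  simp only [linAct, Matrix.SpecialLinearGroup.coe_neg, Matrix.conjTranspose_neg, neg_mul_neg,
    Matrix.neg_mul]

theorem isHermitian_linAct (A : SL2C) {X : Mat2} (h : X.IsHermitian) :
    (linAct A X).IsHermitian :=
  Matrix.isHermitian_mul_mul_conjTranspose _ h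

theorem linAct_inv_eq_iff {A : SL2C} {X Y : Mat2} : linAct A⁻¹ X = Y ↔ X = linAct A Y := by
  constructor <;> rintro rfl
  · rw [← linAct_mul, mul_inv_cancel, linAct_one]
  · rw [← linAct_mul, inv_mul_cancel, linAct_one]

end Minkowski

section SpinorNormal

/-- The point `2 κ κ*` of the light cone that corresponds to the spinor `κ`. -/
def spinorNormal (κ : Fin 2 → ℂ) : Mat2 := (2 : ℂ) • Matrix.vecMulVec κ (star κ)

theorem spinorNormal_apply (κ : Fin 2 → ℂ) (i j : Fin 2) :
    spinorNormal κ i j = 2 * (κ i * star (κ j)) := rfl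

theorem spinorNormal_smul (c : ℂ) (κ : Fin 2 → ℂ) :
    spinorNormal (c • κ) = Complex.normSq c • spinorNormal κ := by
  ext i j
  simp only [spinorNormal_apply, Matrix.smul_apply, Pi.smul_apply, smul_eq_mul, star_mul',
    Complex.real_smul, ← Complex.mul_conj, Complex.star_def]
  ring

theorem linAct_spinorNormal (A : SL2C) (κ : Fin 2 → ℂ) :
    linAct A (spinorNormal κ) = spinorNormal (A • κ) := by
  simp only [linAct, spinorNormal, Matrix.mul_smul, Matrix.smul_mul, Matrix.mul_vecMulVec,
    Matrix.vecMulVec_mul, specialLinearGroup_smul_eq_mulVec, Matrix.star_mulVec]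

theorem mink_spinorNormal (κ μ : Fin 2 → ℂ) :
    mink (spinorNormal κ) (spinorNormal μ) = 2 * Complex.normSq (spinorDet κ μ) := by
  rw [mink_apply, div_eq_iff two_ne_zero, mul_right_comm, ← Complex.ofReal_re (2 * 2 * _)]
  congr 1
  push_cast
  rw [← Complex.mul_conj]
  simp only [spinorNormal_apply, spinorDet, map_sub, map_mul, Complex.star_def]
  ring

theorem isHermitian_spinorNormal (κ : Fin 2 → ℂ) : (spinorNormal κ).IsHermitian :=
  ((Matrix.posSemidef_vecMulVec_self_star κ).smul zero_le_two).isHermitian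

theorem spinorNormal_mem_lightCone {κ : Fin 2 → ℂ} (hκ : κ ≠ 0) :
    spinorNormal κ ∈ lightCone := by
  refine ⟨isHermitian_spinorNormal κ, ?_, ?_⟩
  · rw [spinorNormal, Matrix.det_smul, Matrix.det_vecMulVec, mul_zero]
  · rw [spinorNormal, Matrix.trace_smul, Matrix.trace_vecMulVec]
    have h := Matrix.dotProduct_self_star_pos_iff.mpr hκ
    exact (Complex.lt_def.mp (smul_pos zero_lt_two h)).1

theorem exists_spinorNormal_eq {n : Mat2} (hn : n ∈ lightCone) :
    ∃ κ, κ ≠ 0 ∧ spinorNormal κ = n := by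
  obtain ⟨hH, hdet, htr⟩ := hn
  obtain ⟨i, hi⟩ : ∃ i, 0 < (n i i).re := by
    by_contra! h
    rw [Matrix.trace_fin_two, Complex.add_re] at htr
    exact absurd htr (add_nonpos (h 0) (h 1)).not_gt
  have hreal : ((n i i).re : ℂ) = n i i := Complex.conj_eq_iff_re.mp (hH.apply i i)
  have hne : n i i ≠ 0 := fun h => hi.ne' (by rw [h, Complex.zero_re])
  have rank_one (j k : Fin 2) : n j i * n i k = n j k * n i i := by
    rw [Matrix.det_fin_two] at hdet
    fin_cases i <;> fin_cases j <;> fin_cases k <;> simp only [Fin.zero_eta, Fin.mk_one] <;> grind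
  set s : ℝ := √((2 * (n i i).re)⁻¹)
  have normalised : 2 * ((s : ℂ) * s) * n i i = 1 := by
    rw [← hreal, ← Complex.ofReal_mul, Real.mul_self_sqrt (by positivity)]
    exact_mod_cast (by field_simp : 2 * (2 * (n i i).re)⁻¹ * (n i i).re = 1)
  have hs : (s : ℂ) ≠ 0 := fun h => by simp [h] at normalised
  refine ⟨fun j => s * n j i, fun h => mul_ne_zero hs hne (congrFun h i), ?_⟩
  ext j k
  rw [spinorNormal_apply, star_mul', Complex.star_def, Complex.conj_ofReal, ← Complex.star_def,
    hH.apply]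
  linear_combination 2 * s * s * rank_one j k + n j k * normalised

theorem exists_eq_smul_of_spinorNormal_eq {κ μ : Fin 2 → ℂ} (hκ : κ ≠ 0)
    (h : spinorNormal μ = spinorNormal κ) : ∃ u : ℂ, Complex.normSq u = 1 ∧ μ = u • κ := by
  have hdet : spinorDet κ μ = 0 := by
    have h2 := mink_spinorNormal κ μ
    rw [h, mink_spinorNormal, spinorDet_self, map_zero, mul_zero, eq_comm] at h2
    exact Complex.normSq_eq_zero.mp ((mul_eq_zero_iff_left two_ne_zero).mp h2)
  obtain ⟨u, rfl⟩ := exists_eq_smul_of_spinorDet_eq_zero hκ hdet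
  refine ⟨u, ?_, rfl⟩
  have hne : spinorNormal κ ≠ 0 := fun h0 => by
    simpa [h0] using (spinorNormal_mem_lightCone hκ).2.2
  rw [spinorNormal_smul] at h
  exact smul_left_injective ℝ hne (h.trans (one_smul ℝ _).symm)

end SpinorNormal

section SpinFrames

theorem one_eq_spinorNormal_add :
    (1 : Mat2) = (1 / 2 : ℝ) • (spinorNormal ![1, 0] + spinorNormal ![0, 1]) := by
  ext i j
  fin_cases i <;> fin_cases j <;> simp [spinorNormal_apply]

theorem spinorNormal_eq_one_add_eZ : spinorNormal ![1, 0] = 1 + eZ := by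
  ext i j
  fin_cases i <;> fin_cases j <;> norm_num [spinorNormal_apply, eZ]

/-- The parabolic elements that fix the spinor `(1, 0)`. -/
def upper (c : ℂ) : SL2C := ⟨!![1, c; 0, 1], by simp⟩

theorem upper_zero : upper 0 = 1 :=
  Subtype.ext Matrix.one_fin_two.symm

theorem upper_smul (c : ℂ) : upper c • ![1, 0] = (![1, 0] : Fin 2 → ℂ) := by
  ext i
  rw [specialLinearGroup_smul_apply]
  fin_cases i <;> simp [upper]

theorem linAct_upper_one (c : ℂ) : linAct (upper c) 1 = !![1 + c * star c, c; star c, 1] := by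
  ext i j
  fin_cases i <;> fin_cases j <;> simp [linAct, upper, Matrix.mul_apply, Fin.sum_univ_two]

theorem eq_upper_of_smul_eq {U : SL2C} (h : U • ![1, 0] = (![1, 0] : Fin 2 → ℂ)) :
    U = upper (U.1 0 1) := by
  have h00 : U.1 0 0 = 1 := by simpa [specialLinearGroup_smul_apply] using congrFun h 0
  have h10 : U.1 1 0 = 0 := by simpa [specialLinearGroup_smul_apply] using congrFun h 1
  have h11 : U.1 1 1 = 1 := by
    simpa [h00, h10] using (Matrix.det_fin_two U.1).symm.trans U.det_coe
  ext i j
  fin_cases i <;> fin_cases j <;> simp [upper, h00, h10, h11]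

theorem eq_one_of_linAct_one_of_smul_eq {U : SL2C} (h1 : linAct U 1 = 1)
    (he : U • ![1, 0] = (![1, 0] : Fin 2 → ℂ)) : U = 1 := by
  rw [eq_upper_of_smul_eq he] at h1 ⊢
  have h01 := congrFun₂ h1 0 1
  rw [linAct_upper_one] at h01
  rw [show U.1 0 1 = 0 from h01, upper_zero]

theorem mul_eY_mul_transpose (A : SL2C) : A.1 * eY * A.1ᵀ = eY := by
  have hA := A.det_coe
  rw [Matrix.det_fin_two] at hA
  ext i j
  fin_cases i <;> fin_cases j <;>
    simp [eY, Matrix.mul_apply, Fin.sum_univ_two] <;> grind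

theorem linAct_eY_eq_iff (A : SL2C) :
    linAct A eY = eY ↔ Matrix.SpecialLinearGroup.map (starRingEnd ℂ) A = A := by
  have eY_mul_eY : eY * eY = 1 := by
    simp [eY, Matrix.one_fin_two]
  have hunit : IsUnit (A.1 * eY) :=
    (Matrix.isUnit_iff_isUnit_det A.1 |>.mpr (by simp)).mul (IsUnit.of_mul_eq_one _ eY_mul_eY)
  calc linAct A eY = eY ↔ A.1 * eY * A.1ᴴ = A.1 * eY * A.1ᵀ := by
        rw [mul_eY_mul_transpose]; rfl
    _ ↔ A.1ᴴᵀ = A.1 := by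
        rw [hunit.mul_right_inj, ← Matrix.transpose_inj, Matrix.transpose_transpose]
    _ ↔ Matrix.SpecialLinearGroup.map (starRingEnd ℂ) A = A :=
      (Subtype.ext_iff (a1 := Matrix.SpecialLinearGroup.map (starRingEnd ℂ) A)).symm

namespace SpinFrame

/-- The spinor `W (1, 0)`: the outward spin frames of a spin-decorated horosphere are those with
one spinor. -/
def spinor (W : SpinFrame) : Fin 2 → ℂ := W • ![1, 0]

theorem spinor_mul (A : SL2C) (W : SpinFrame) : spinor (A * W) = A • W.spinor := mul_smul A W _

theorem spinor_neg (W : SpinFrame) : spinor (-W) = -W.spinor := by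
  simp only [spinor, specialLinearGroup_smul_eq_mulVec, Matrix.SpecialLinearGroup.coe_neg,
    Matrix.neg_mulVec]

theorem spinor_ne_zero (W : SpinFrame) : W.spinor ≠ 0 :=
  smul_ne_zero_iff_ne W |>.mpr (by simp)

theorem basepoint_mul (A : SL2C) (W : SpinFrame) : basepoint (A * W) = A • W.basepoint :=
  mul_smul A W basePoint

theorem coe_basepoint (W : SpinFrame) : (W.basepoint : Mat2) = linAct W 1 := rfl

theorem basepoint_neg (W : SpinFrame) : basepoint (-W) = W.basepoint :=
  Subtype.ext (linAct_neg_left W 1)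

theorem frame_zero (W : SpinFrame) : W.frame 0 = spinorNormal W.spinor - W.basepoint := by
  rw [spinor, ← linAct_spinorNormal, spinorNormal_eq_one_add_eZ, coe_basepoint, linAct_add,
    add_sub_cancel_left]
  rfl

theorem frame_one (W : SpinFrame) : W.frame 1 = linAct W eY := rfl

theorem frame_one_neg (W : SpinFrame) : frame (-W) 1 = W.frame 1 := linAct_neg_left W eY

theorem coe_basepoint_eq_spinorNormal_add (W : SpinFrame) :
    (W.basepoint : Mat2) =
      (1 / 2 : ℝ) • (spinorNormal (W • ![1, 0]) + spinorNormal (W • ![0, 1])) := by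
  rw [coe_basepoint, one_eq_spinorNormal_add, linAct_smul, linAct_add, linAct_spinorNormal,
    linAct_spinorNormal]

theorem ext_of_basepoint_of_spinor {W W' : SpinFrame} (hb : W.basepoint = W'.basepoint)
    (hs : W.spinor = W'.spinor) : W = W' := by
  refine eq_of_inv_mul_eq_one (eq_one_of_linAct_one_of_smul_eq ?_ ?_)
  · rw [linAct_mul, linAct_inv_eq_iff]
    exact congrArg Subtype.val hb.symm
  · rw [mul_smul, inv_smul_eq_iff]; exact hs.symm

theorem spinor_eq_or_eq_neg {W W' : SpinFrame} (h0 : spinorNormal W'.spinor = spinorNormal W.spinor)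
    (h1 : W'.frame 1 = W.frame 1) : W'.spinor = W.spinor ∨ W'.spinor = -W.spinor := by
  obtain ⟨u, hu, huW⟩ := exists_eq_smul_of_spinorNormal_eq W.spinor_ne_zero h0
  have hU : (W⁻¹ * W') • ![1, 0] = u • (![1, 0] : Fin 2 → ℂ) := by
    rw [mul_smul, inv_smul_eq_iff, smul_comm]; exact huW
  have hreal : starRingEnd ℂ u = u := by
    have hY : linAct (W⁻¹ * W') eY = eY := by
      rw [linAct_mul, linAct_inv_eq_iff]; exact h1
    have h00 := congrArg (fun A : SL2C => A.1 0 0) ((linAct_eY_eq_iff _).mp hY)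
    have hu00 : (W⁻¹ * W').1 0 0 = u := by
      simpa [specialLinearGroup_smul_apply] using congrFun hU 0
    rwa [← hu00]
  have hsq : u * u = 1 := by
    rw [← Complex.ofReal_one, ← hu, ← Complex.mul_conj, hreal]
  rcases mul_self_eq_one_iff.mp hsq with rfl | rfl
  · exact .inl (huW.trans (one_smul ℂ _))
  · exact .inr (huW.trans (neg_one_smul ℂ _))

theorem frame_one_eq_of_spinor {W W' : SpinFrame} (hb : W.basepoint = W'.basepoint)
    (hs : W.spinor = W'.spinor ∨ W.spinor = -W'.spinor) : W.frame 1 = W'.frame 1 := by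
  rcases hs with hs | hs
  · rw [ext_of_basepoint_of_spinor hb hs]
  · rw [ext_of_basepoint_of_spinor (hb.trans (basepoint_neg W').symm)
      (hs.trans (spinor_neg W').symm), frame_one_neg]

end SpinFrame

end SpinFrames

section Horosphere

theorem smul_mem_horosphere_iff {A : SL2C} {S : H3} {κ : Fin 2 → ℂ} :
    A • S ∈ horosphere (spinorNormal (A • κ)) ↔ S ∈ horosphere (spinorNormal κ) := by
  simp only [horosphere, Set.mem_ofPred_eq, coe_smul, ← linAct_spinorNormal, mink_linAct]

theorem basepoint_mem_horosphere (W : SpinFrame) :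
    W.basepoint ∈ horosphere (spinorNormal W.spinor) := by
  refine smul_mem_horosphere_iff.mpr ?_
  simp [horosphere, basePoint, mink_apply, spinorNormal_apply]

theorem eq_basepoint_upper_of_mem_horosphere {S : H3}
    (hS : S ∈ horosphere (spinorNormal ![1, 0])) :
    S = SpinFrame.basepoint (upper (S.1 0 1)) := by
  have hH := S.2.1.isHermitian
  have h10 : star (S.1 0 1) = S.1 1 0 := hH.apply 1 0
  have h11 : S.1 1 1 = 1 := by
    have hre : (S.1 1 1).re = 1 := by
      simpa [horosphere, mink_apply, spinorNormal_apply] using hS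
    rw [← Complex.conj_eq_iff_re.mp (hH.apply 1 1), hre, Complex.ofReal_one]
  have h00 : S.1 0 0 = 1 + S.1 0 1 * S.1 1 0 := by
    have hdet := S.2.2
    rw [Matrix.det_fin_two, h11] at hdet
    linear_combination hdet
  apply Subtype.ext
  rw [SpinFrame.coe_basepoint, linAct_upper_one, h10, ← h00]
  exact (Matrix.eta_fin_two S.1).trans (by rw [h11])

/-- For a point `S` of the horosphere of the spinor of `A`, the spin frame at `S` with the same
spinor as `A`. -/
def frameThrough (A : SL2C) (S : H3) : SpinFrame := A * upper ((A⁻¹ • S).1 0 1)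

theorem spinor_mul_upper (A : SL2C) (c : ℂ) :
    SpinFrame.spinor (A * upper c) = SpinFrame.spinor A := by
  rw [SpinFrame.spinor_mul, SpinFrame.spinor, upper_smul, SpinFrame.spinor]

theorem spinor_frameThrough (A : SL2C) (S : H3) :
    (frameThrough A S).spinor = SpinFrame.spinor A :=
  spinor_mul_upper A _

theorem basepoint_frameThrough {A : SL2C} {S : H3}
    (hS : S ∈ horosphere (spinorNormal (SpinFrame.spinor A))) :
    (frameThrough A S).basepoint = S := by
  have hS' : A⁻¹ • S ∈ horosphere (spinorNormal ![1, 0]) := by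
    rwa [← smul_mem_horosphere_iff (A := A), smul_inv_smul]
  rw [frameThrough, SpinFrame.basepoint_mul, ← eq_basepoint_upper_of_mem_horosphere hS',
    smul_inv_smul]

theorem continuous_upper : Continuous upper :=
  Continuous.subtype_mk (continuous_matrix fun i j => by
    fin_cases i <;> fin_cases j
    exacts [continuous_const, continuous_id, continuous_const, continuous_const]) _

theorem continuous_basepoint : Continuous SpinFrame.basepoint :=
  Continuous.subtype_mk (by simp only [linAct]; fun_prop) _

theorem continuous_frameThrough (A : SL2C) : Continuous (frameThrough A) := by
  have hsmul : Continuous fun S : H3 => linAct A⁻¹ S.1 := by simp only [linAct]; fun_prop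
  exact continuous_const.mul (continuous_upper.comp (hsmul.matrix_elem 0 1))

theorem horosphere_spinor_eq_range (A : SL2C) :
    horosphere (spinorNormal (SpinFrame.spinor A)) =
      Set.range fun c => SpinFrame.basepoint (A * upper c) := by
  ext S
  refine ⟨fun hS => ⟨_, basepoint_frameThrough hS⟩, ?_⟩
  rintro ⟨c, rfl⟩
  simpa only [spinor_mul_upper] using basepoint_mem_horosphere (A * upper c)

theorem isPreconnected_horosphere {n : Mat2} (hn : n ∈ lightCone) :
    IsPreconnected (horosphere n) := by
  obtain ⟨κ, hκ, rfl⟩ := exists_spinorNormal_eq hn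
  obtain ⟨A, rfl⟩ := exists_smul_eq_of_ne_zero hκ
  rw [← SpinFrame.spinor, horosphere_spinor_eq_range]
  exact isPreconnected_range (continuous_basepoint.comp (continuous_const.mul continuous_upper))

theorem horosphere_nonempty {n : Mat2} (hn : n ∈ lightCone) : (horosphere n).Nonempty := by
  obtain ⟨κ, hκ, rfl⟩ := exists_spinorNormal_eq hn
  obtain ⟨A, rfl⟩ := exists_smul_eq_of_ne_zero hκ
  exact ⟨_, basepoint_mem_horosphere A⟩

end Horosphere

section HorosphericTriple

/-- Three points with the mutual distances of collinear points at positions `0, 1, -1` in the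
intrinsic Euclidean metric of a horosphere. Such a triple on a horosphere determines its normal,
which makes the normal visible to isometries that are only known to map horosphere to horosphere. -/
def IsHorosphericTriple (S₀ S₁ S₂ : Mat2) : Prop :=
  mink S₀ S₁ = 3 / 2 ∧ mink S₀ S₂ = 3 / 2 ∧ mink S₁ S₂ = 3

theorem mink_basepoint_upper (W : SpinFrame) (a b : ℂ) :
    mink (SpinFrame.basepoint (W * upper a)) (SpinFrame.basepoint (W * upper b)) =
      1 + Complex.normSq (a - b) / 2 := by
  rw [SpinFrame.coe_basepoint, SpinFrame.coe_basepoint, linAct_mul, linAct_mul, mink_linAct,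
    linAct_upper_one, linAct_upper_one, mink_apply]
  simp [Complex.normSq_apply]
  ring

theorem isHorosphericTriple_basepoint_upper (W : SpinFrame) :
    IsHorosphericTriple (SpinFrame.basepoint (W * upper 0)) (SpinFrame.basepoint (W * upper 1))
      (SpinFrame.basepoint (W * upper (-1))) := by
  simp only [IsHorosphericTriple, mink_basepoint_upper]
  norm_num [Complex.normSq_apply]

theorem IsHorosphericTriple.normal_eq {n : Mat2} (hn : n ∈ lightCone) {S₀ S₁ S₂ : H3}
    (h₀ : S₀ ∈ horosphere n) (h₁ : S₁ ∈ horosphere n) (h₂ : S₂ ∈ horosphere n)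
    (h : IsHorosphericTriple S₀.1 S₁ S₂) : n = S₁.1 + S₂.1 - (2 : ℝ) • S₀.1 := by
  obtain ⟨κ, hκ, rfl⟩ := exists_spinorNormal_eq hn
  obtain ⟨A, rfl⟩ := exists_smul_eq_of_ne_zero hκ
  rw [← SpinFrame.spinor, horosphere_spinor_eq_range] at h₀ h₁ h₂
  obtain ⟨c, rfl⟩ := h₀
  obtain ⟨c₁, rfl⟩ := h₁
  obtain ⟨c₂, rfl⟩ := h₂
  obtain ⟨a, rfl⟩ : ∃ a, c₁ = c + a := ⟨c₁ - c, by ring⟩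
  obtain ⟨b, rfl⟩ : ∃ b, c₂ = c + b := ⟨c₂ - c, by ring⟩
  simp only [IsHorosphericTriple, mink_basepoint_upper, sub_add_cancel_left,
    add_sub_add_left_eq_sub, Complex.normSq_neg] at h
  obtain ⟨ha, hb, hab⟩ := h
  have hopposite : b = -a := by
    have parallelogram : Complex.normSq (a + b) + Complex.normSq (a - b) =
        2 * (Complex.normSq a + Complex.normSq b) := by
      rw [Complex.normSq_add, Complex.normSq_sub]; ring
    rw [eq_neg_iff_add_eq_zero, add_comm, ← Complex.normSq_eq_zero]
    linarith
  subst hopposite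
  have hunit : a * starRingEnd ℂ a = 1 := by
    rw [Complex.mul_conj, show Complex.normSq a = 1 by linarith,
      Complex.ofReal_one]
  simp only [SpinFrame.coe_basepoint, ← linAct_spinorNormal, linAct_mul,
    ← linAct_add, ← linAct_smul, ← linAct_sub, linAct_upper_one]
  congr 1
  ext i j
  fin_cases i <;> fin_cases j <;> simp [spinorNormal_apply]
  · linear_combination -2 * hunit
  all_goals ring

theorem linAct_eq_of_smul_mem_horosphere {P : SL2C} {n n' : Mat2} (hn : n ∈ lightCone)
    (hn' : n' ∈ lightCone) (hP : ∀ S ∈ horosphere n, P • S ∈ horosphere n') :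
    linAct P n = n' := by
  obtain ⟨κ, hκ, rfl⟩ := exists_spinorNormal_eq hn
  obtain ⟨A, rfl⟩ := exists_smul_eq_of_ne_zero hκ
  have hmem (c : ℂ) : SpinFrame.basepoint (A * upper c) ∈ horosphere (spinorNormal (A • ![1, 0])) :=
    (horosphere_spinor_eq_range A).ge ⟨c, rfl⟩
  have triple := isHorosphericTriple_basepoint_upper A
  have image_triple : IsHorosphericTriple (P • SpinFrame.basepoint (A * upper 0) : H3)
      (P • SpinFrame.basepoint (A * upper 1) : H3)
      (P • SpinFrame.basepoint (A * upper (-1)) : H3) := by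
    simpa only [IsHorosphericTriple, coe_smul, mink_linAct] using triple
  rw [triple.normal_eq hn (hmem 0) (hmem 1) (hmem (-1)),
    image_triple.normal_eq hn' (hP _ (hmem 0)) (hP _ (hmem 1)) (hP _ (hmem (-1)))]
  simp only [coe_smul, linAct_add, linAct_sub, linAct_smul]

theorem smul_eq_or_eq_neg_of_parabolic {P : SL2C} {κ : Fin 2 → ℂ} (hκ : κ ≠ 0)
    (ht : P.1.trace = 2 ∨ P.1.trace = -2)
    (hP : ∀ S ∈ horosphere (spinorNormal κ), P • S ∈ horosphere (spinorNormal κ)) :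
    P • κ = κ ∨ P • κ = -κ := by
  have hn := spinorNormal_mem_lightCone hκ
  have hfix := linAct_eq_of_smul_mem_horosphere hn hn hP
  rw [linAct_spinorNormal] at hfix
  obtain ⟨u, -, hu⟩ := exists_eq_smul_of_spinorNormal_eq hκ hfix
  have characteristic : u ^ 2 - P.1.trace * u + 1 = 0 := by
    have hker : (P.1 - u • 1) *ᵥ κ = 0 := by
      rw [Matrix.sub_mulVec, Matrix.smul_mulVec, Matrix.one_mulVec, sub_eq_zero]; exact hu
    have hdet := Matrix.exists_mulVec_eq_zero_iff.mp ⟨κ, hκ, hker⟩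
    have hP1 := P.det_coe
    simp only [Matrix.det_fin_two, Matrix.sub_apply, Matrix.smul_apply, Matrix.one_apply,
      smul_eq_mul, Fin.reduceEq, if_true, if_false, mul_one, mul_zero, sub_zero] at hdet hP1
    rw [Matrix.trace_fin_two]
    linear_combination hdet - hP1
  rcases ht with ht | ht <;> rw [ht] at characteristic
  · have hu1 : u - 1 = 0 := pow_eq_zero_iff two_ne_zero |>.mp (by linear_combination characteristic)
    exact .inl (by rw [hu, sub_eq_zero.mp hu1, one_smul])
  · have hu1 : u + 1 = 0 := pow_eq_zero_iff two_ne_zero |>.mp (by linear_combination characteristic)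
    exact .inr (by rw [hu, eq_neg_of_add_eq_zero_left hu1, neg_one_smul])

end HorosphericTriple

section Decoration

theorem coe_rotSecond_pi : (rotSecond Real.pi).1 = !![0, -1; 1, 0] := by
  simp [rotSecond]

theorem rotSecond_pi_smul (x y : ℂ) : rotSecond Real.pi • ![x, y] = ![-y, x] := by
  ext i
  rw [specialLinearGroup_smul_apply, coe_rotSecond_pi]
  fin_cases i <;> simp

theorem linAct_rotSecond_pi_one : linAct (rotSecond Real.pi) 1 = 1 := by
  rw [linAct, coe_rotSecond_pi]
  ext i j
  fin_cases i <;> fin_cases j <;> simp [Matrix.mul_apply]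

theorem linAct_rotSecond_pi_eZ : linAct (rotSecond Real.pi) eZ = -eZ := by
  rw [linAct, coe_rotSecond_pi]
  ext i j
  fin_cases i <;> fin_cases j <;> simp [eZ, Matrix.mul_apply, Fin.sum_univ_two]

theorem linAct_rotSecond_pi_eY : linAct (rotSecond Real.pi) eY = eY := by
  rw [linAct, coe_rotSecond_pi]
  ext i j
  fin_cases i <;> fin_cases j <;> simp [eY, Matrix.mul_apply, Fin.sum_univ_two]

namespace SpinFrame

theorem basepoint_mul_rotSecond_pi (W : SpinFrame) :
    basepoint (W * rotSecond Real.pi) = W.basepoint :=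
  Subtype.ext (by rw [coe_basepoint, coe_basepoint, linAct_mul, linAct_rotSecond_pi_one])

theorem frame_zero_mul_rotSecond_pi (W : SpinFrame) :
    frame (W * rotSecond Real.pi) 0 = -W.frame 0 := by
  change linAct _ eZ = -linAct _ eZ
  rw [linAct_mul, linAct_rotSecond_pi_eZ, linAct_neg]

theorem frame_one_mul_rotSecond_pi (W : SpinFrame) :
    frame (W * rotSecond Real.pi) 1 = W.frame 1 := by
  rw [frame_one, frame_one, linAct_mul, linAct_rotSecond_pi_eY]

theorem isHermitian_frame_one (W : SpinFrame) : (W.frame 1).IsHermitian := by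
  refine isHermitian_linAct W ?_
  ext i j
  fin_cases i <;> fin_cases j <;> simp [eY]

theorem mink_frame_one_basepoint (W : SpinFrame) : mink (W.frame 1) W.basepoint = 0 := by
  rw [frame_one, coe_basepoint, mink_linAct, mink_apply]
  simp [eY]

theorem mink_frame_one_spinorNormal (W : SpinFrame) :
    mink (W.frame 1) (spinorNormal W.spinor) = 0 := by
  rw [frame_one, spinor, ← linAct_spinorNormal, mink_linAct, mink_apply]
  simp [eY, spinorNormal_apply]

theorem mink_frame_one_self (W : SpinFrame) : mink (W.frame 1) (W.frame 1) = -1 := by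
  rw [frame_one, mink_linAct, mink_self]
  simp [eY]

end SpinFrame

theorem isParallelUnitField_frameThrough (A : SL2C) :
    IsParallelUnitField (spinorNormal (SpinFrame.spinor A))
      (fun S => (frameThrough A S).frame 1) := by
  refine ⟨fun S => ⟨SpinFrame.isHermitian_frame_one _, ?_, ?_, SpinFrame.mink_frame_one_self _⟩,
    fun P ht hP S S' hS => ?_⟩
  · simpa only [basepoint_frameThrough S.2] using
      SpinFrame.mink_frame_one_basepoint (frameThrough A S)
  · simpa only [spinor_frameThrough] using
      SpinFrame.mink_frame_one_spinorNormal (frameThrough A S)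
  · have hbase : (frameThrough A S').basepoint =
        SpinFrame.basepoint (P * frameThrough A S) := by
      rw [SpinFrame.basepoint_mul, basepoint_frameThrough S.2, basepoint_frameThrough S'.2, hS]
    have hspinor : (frameThrough A S').spinor = SpinFrame.spinor (P * frameThrough A S) ∨
        (frameThrough A S').spinor = -SpinFrame.spinor (P * frameThrough A S) := by
      rw [SpinFrame.spinor_mul, spinor_frameThrough, spinor_frameThrough]
      have hPκ := smul_eq_or_eq_neg_of_parabolic (SpinFrame.spinor_ne_zero A) ht fun S => (hP S).mpr
      rcases hPκ with h | h <;> rw [h]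
      · exact .inl rfl
      · exact .inr (neg_neg _).symm
    change (frameThrough A S').frame 1 = linAct P ((frameThrough A S).frame 1)
    rw [SpinFrame.frame_one_eq_of_spinor hbase hspinor, SpinFrame.frame_one, linAct_mul,
      SpinFrame.frame_one]

/-- The spin-decorated horosphere of the spinor of `A`. -/
def decorationThrough (A : SL2C) : SpinDecoratedHorosphere where
  normal := spinorNormal (SpinFrame.spinor A)
  normal_mem := spinorNormal_mem_lightCone (SpinFrame.spinor_ne_zero A)
  inward S := frameThrough A S * rotSecond Real.pi
  outward S := frameThrough A S
  isSpinDecoration := by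
    have hcont := (continuous_frameThrough A).comp
      (continuous_subtype_val (p := (· ∈ horosphere (spinorNormal (SpinFrame.spinor A)))))
    have hbase (S : horosphere (spinorNormal (SpinFrame.spinor A))) :
        (frameThrough A S).basepoint = S := basepoint_frameThrough S.2
    have hzero (S : horosphere (spinorNormal (SpinFrame.spinor A))) :
        (frameThrough A S).frame 0 = spinorNormal (SpinFrame.spinor A) - S.1.1 := by
      rw [SpinFrame.frame_zero, spinor_frameThrough, hbase]
    refine ⟨⟨_, isParallelUnitField_frameThrough A, ⟨hcont.mul continuous_const, fun S => ?_⟩,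
      hcont, fun S => ⟨hbase S, hzero S, rfl⟩⟩, fun S => rfl⟩
    rw [SpinFrame.basepoint_mul_rotSecond_pi, SpinFrame.frame_zero_mul_rotSecond_pi,
      SpinFrame.frame_one_mul_rotSecond_pi, hzero, neg_sub]
    exact ⟨hbase S, rfl, rfl⟩

theorem exists_correspondsTo {κ : Fin 2 → ℂ} (hκ : κ ≠ 0) : ∃ D, CorrespondsTo D κ := by
  obtain ⟨A, rfl⟩ := exists_smul_eq_of_ne_zero hκ
  exact ⟨decorationThrough A, rfl, fun S => spinor_frameThrough A S⟩

namespace SpinDecoratedHorosphere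

variable (D : SpinDecoratedHorosphere)

theorem inward_eq (S : horosphere D.normal) : D.inward S = D.outward S * rotSecond Real.pi :=
  D.isSpinDecoration.2 S

theorem continuous_outward : Continuous D.outward :=
  D.isSpinDecoration.1.choose_spec.2.2.1

theorem basepoint_outward (S : horosphere D.normal) : (D.outward S).basepoint = S :=
  (D.isSpinDecoration.1.choose_spec.2.2.2 S).1

theorem spinorNormal_spinor_outward (S : horosphere D.normal) :
    spinorNormal (D.outward S).spinor = D.normal := by
  have hzero := (D.isSpinDecoration.1.choose_spec.2.2.2 S).2.1
  rwa [SpinFrame.frame_zero, basepoint_outward, sub_left_inj] at hzero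

theorem frame_one_outward_smul {P : SL2C} (ht : P.1.trace = 2)
    (hP : linAct P D.normal = D.normal) {S S' : horosphere D.normal} (hS : (S' : H3) = P • S.1) :
    (D.outward S').frame 1 = linAct P ((D.outward S).frame 1) := by
  obtain ⟨V, hV, -, -, hout⟩ := D.isSpinDecoration.1
  rw [(hout S').2.2, (hout S).2.2]
  refine hV.2 P (.inl ht) (fun T => ?_) S S' hS
  change mink (linAct P T.1) D.normal = 1 ↔ mink T.1 D.normal = 1
  rw [← mink_linAct P T.1, hP]

theorem spinor_outward_eq_or_eq_neg (S S' : horosphere D.normal) :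
    (D.outward S').spinor = (D.outward S).spinor ∨
      (D.outward S').spinor = -(D.outward S).spinor := by
  set A := D.outward S
  have hn : spinorNormal (SpinFrame.spinor A) = D.normal := D.spinorNormal_spinor_outward S
  have hbase : (frameThrough A S').basepoint = S' := by
    refine basepoint_frameThrough ?_
    rw [hn]; exact S'.2
  have hspinor := spinor_frameThrough A S'
  obtain ⟨P, htrace, hP⟩ : ∃ P : SL2C, P.1.trace = 2 ∧ P * A = frameThrough A S' := by
    refine ⟨frameThrough A S' * A⁻¹, ?_, inv_mul_cancel_right _ _⟩
    rw [frameThrough, Matrix.SpecialLinearGroup.coe_mul, Matrix.trace_mul_comm,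
      ← Matrix.SpecialLinearGroup.coe_mul, inv_mul_cancel_left, Matrix.trace_fin_two]
    exact one_add_one_eq_two
  rw [← hspinor]
  refine SpinFrame.spinor_eq_or_eq_neg ?_ ?_
  · rw [hspinor, hn, spinorNormal_spinor_outward]
  · rw [← hP, SpinFrame.frame_one (P * A), linAct_mul]
    refine D.frame_one_outward_smul htrace ?_ ?_
    · rw [← hn, linAct_spinorNormal, ← SpinFrame.spinor_mul, hP, hspinor]
    · rw [← hbase, ← hP, SpinFrame.basepoint_mul, ← D.basepoint_outward S]

theorem exists_spinor_correspondsTo : ∃ κ, κ ≠ 0 ∧ CorrespondsTo D κ := by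
  obtain ⟨S₀, hS₀⟩ := horosphere_nonempty D.normal_mem
  set κ := (D.outward ⟨S₀, hS₀⟩).spinor
  refine ⟨κ, SpinFrame.spinor_ne_zero _, (D.spinorNormal_spinor_outward _).symm, fun S => ?_⟩
  have hspinor : Continuous fun W : SpinFrame => W.spinor :=
    continuous_subtype_val.matrix_mulVec continuous_const
  have := isPreconnected_iff_preconnectedSpace.mp (isPreconnected_horosphere D.normal_mem)
  exact isPreconnected_univ.constant_of_mapsTo (T := {κ, -κ}) (Set.toFinite _).isDiscrete
    (hspinor.comp D.continuous_outward).continuousOn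
    (fun S _ => D.spinor_outward_eq_or_eq_neg _ S) trivial trivial

end SpinDecoratedHorosphere

theorem CorrespondsTo.ext {D D' : SpinDecoratedHorosphere} {κ : Fin 2 → ℂ}
    (h : CorrespondsTo D κ) (h' : CorrespondsTo D' κ) : D = D' := by
  have outward_eq (S S') (hS : S.1 = S'.1) : D.outward S = D'.outward S' :=
    SpinFrame.ext_of_basepoint_of_spinor (by rw [D.basepoint_outward, D'.basepoint_outward, hS])
      ((h.2 S).trans (h'.2 S').symm)
  have inward_eq (S S') (hS : S.1 = S'.1) : D.inward S = D'.inward S' := by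
    rw [D.inward_eq, D'.inward_eq, outward_eq S S' hS]
  have normal_eq : D.normal = D'.normal := h.1.trans h'.1.symm
  clear h h'
  obtain ⟨n, _, Win, Wout, _⟩ := D
  obtain ⟨n', _, Win', Wout', _⟩ := D'
  obtain rfl : n = n' := normal_eq
  obtain rfl : Win = Win' := funext fun S => inward_eq S S rfl
  obtain rfl : Wout = Wout' := funext fun S => outward_eq S S rfl
  rfl

theorem CorrespondsTo.unique {D : SpinDecoratedHorosphere} {κ μ : Fin 2 → ℂ}
    (h : CorrespondsTo D κ) (h' : CorrespondsTo D μ) : κ = μ := by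
  obtain ⟨S, hS⟩ := horosphere_nonempty D.normal_mem
  exact (h.2 ⟨S, hS⟩).symm.trans (h'.2 ⟨S, hS⟩)

end Decoration

section LambdaLength

theorem screwFirst_smul (d x y : ℂ) :
    screwFirst d • ![x, y] = ![Complex.exp (d / 2) * x, Complex.exp (-d / 2) * y] := by
  ext i
  rw [specialLinearGroup_smul_apply]
  fin_cases i <;> simp [screwFirst]

theorem mul_rotSecond_pi_mul_screwFirst_smul (W : SpinFrame) (d x y : ℂ) :
    (W * rotSecond Real.pi * screwFirst d) • ![x, y] =
      W • ![-(Complex.exp (-d / 2) * y), Complex.exp (d / 2) * x] := by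
  rw [mul_smul, mul_smul, screwFirst_smul, rotSecond_pi_smul]

variable {D₁ D₂ : SpinDecoratedHorosphere} {κ₁ κ₂ : Fin 2 → ℂ}

theorem IsHorosphereDistance.exp_half_eq (h₁ : CorrespondsTo D₁ κ₁) (h₂ : CorrespondsTo D₂ κ₂)
    {d : ℂ} (h : IsHorosphereDistance D₁ D₂ d) : Complex.exp (d / 2) = spinorDet κ₁ κ₂ := by
  obtain ⟨q₁, q₂, -, -, h⟩ := h
  rw [IsComplexDistance, D₁.inward_eq] at h
  have hκ₁ : κ₁ = D₁.outward q₁ • ![1, 0] := (h₁.2 q₁).symm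
  have hκ₂ : κ₂ = D₁.outward q₁ • ![0, Complex.exp (d / 2)] := by
    rw [← h₂.2 q₂, h]
    exact (mul_rotSecond_pi_mul_screwFirst_smul (D₁.outward q₁) d 1 0).trans
      (by simp only [mul_one, mul_zero, neg_zero])
  rw [hκ₁, hκ₂, spinorDet_specialLinearGroup_smul]
  simp [spinorDet]

theorem CorrespondsTo.exists_outward_eq {D : SpinDecoratedHorosphere} {W : SpinFrame}
    (h : CorrespondsTo D W.spinor) :
    ∃ q : horosphere D.normal, q = W.basepoint ∧ D.outward q = W := by
  have hq : W.basepoint ∈ horosphere D.normal := by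
    rw [h.1]; exact basepoint_mem_horosphere W
  exact ⟨⟨_, hq⟩, rfl, SpinFrame.ext_of_basepoint_of_spinor (D.basepoint_outward _) (h.2 _)⟩

theorem CorrespondsTo.onGeodesic (h₁ : CorrespondsTo D₁ κ₁) (h₂ : CorrespondsTo D₂ κ₂)
    {S : H3} {a b : ℂ} (ha : a ≠ 0) (hb : b ≠ 0)
    (hS : S.1 = (1 / 2 : ℝ) • (spinorNormal (a • κ₁) + spinorNormal (b • κ₂))) :
    OnGeodesic D₁.normal D₂.normal S := by
  have ha' := Complex.normSq_pos.mpr ha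
  have hb' := Complex.normSq_pos.mpr hb
  refine ⟨1 / 2 * Complex.normSq a, 1 / 2 * Complex.normSq b, by positivity, by positivity, ?_⟩
  rw [hS, smul_add, spinorNormal_smul, spinorNormal_smul, smul_smul, smul_smul, h₁.1, h₂.1]
  rfl

theorem exists_isHorosphereDistance (h₁ : CorrespondsTo D₁ κ₁) (h₂ : CorrespondsTo D₂ κ₂)
    (h : spinorDet κ₁ κ₂ ≠ 0) : ∃ d, IsHorosphereDistance D₁ D₂ d := by
  set l := spinorDet κ₁ κ₂
  have hl : spinorDet κ₁ (l⁻¹ • κ₂) = 1 := by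
    rw [spinorDet_smul_right, inv_mul_cancel₀ h]
  set W₁ : SpinFrame := ofColumns κ₁ (l⁻¹ • κ₂) hl
  set d := 2 * Complex.log l
  have hexp : Complex.exp (d / 2) = l := by
    rw [mul_div_cancel_left₀ _ two_ne_zero, Complex.exp_log h]
  have hexp_neg : Complex.exp (-d / 2) = l⁻¹ := by rw [neg_div, Complex.exp_neg, hexp]
  set W₂ : SpinFrame := W₁ * rotSecond Real.pi * screwFirst d
  have hW₁ (x y : ℂ) : W₁ • ![x, y] = x • κ₁ + (y * l⁻¹) • κ₂ := by
    rw [ofColumns_smul, smul_smul]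
  have hW₂ (x y : ℂ) : W₂ • ![x, y] = (-(l⁻¹ * y)) • κ₁ + x • κ₂ := by
    rw [mul_rotSecond_pi_mul_screwFirst_smul, hexp, hexp_neg, hW₁, mul_right_comm,
      mul_inv_cancel₀ h, one_mul]
  have hspinor₁ : W₁.spinor = κ₁ := (hW₁ 1 0).trans (by simp)
  have hspinor₂ : W₂.spinor = κ₂ := (hW₂ 1 0).trans (by simp)
  obtain ⟨q₁, hq₁, hout₁⟩ := CorrespondsTo.exists_outward_eq (hspinor₁.symm ▸ h₁)
  obtain ⟨q₂, hq₂, hout₂⟩ := CorrespondsTo.exists_outward_eq (hspinor₂.symm ▸ h₂)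
  refine ⟨d, q₁, q₂, ?_, ?_, by rw [IsComplexDistance, D₁.inward_eq, hout₁, hout₂]⟩
  · refine h₁.onGeodesic h₂ one_ne_zero (inv_ne_zero h) ?_
    rw [hq₁, SpinFrame.coe_basepoint_eq_spinorNormal_add, hW₁, hW₁]
    simp
  · refine h₁.onGeodesic h₂ (neg_ne_zero.mpr (inv_ne_zero h)) one_ne_zero ?_
    rw [hq₂, SpinFrame.coe_basepoint_eq_spinorNormal_add, hW₂, hW₂, add_comm]
    simp

theorem lambdaLength_eq_spinorDet (h₁ : CorrespondsTo D₁ κ₁) (h₂ : CorrespondsTo D₂ κ₂) :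
    lambdaLength D₁ D₂ = spinorDet κ₁ κ₂ := by
  rw [lambdaLength]
  split_ifs with h
  · exact h.choose_spec.exp_half_eq h₁ h₂
  · by_contra hne
    exact h (exists_isHorosphereDistance h₁ h₂ (Ne.symm hne))

theorem CorrespondsTo.maps_iff {A : SL2C} (h₁ : CorrespondsTo D₁ κ₁) (h₂ : CorrespondsTo D₂ κ₂) :
    Maps A D₁ D₂ ↔ κ₂ = A • κ₁ := by
  constructor
  · rintro ⟨hnormal, hmaps⟩
    obtain ⟨S, hS⟩ := horosphere_nonempty D₁.normal_mem
    have hS' : A • S ∈ horosphere D₂.normal := by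
      change mink (linAct A S.1) D₂.normal = 1
      rwa [hnormal, mink_linAct]
    rw [← h₁.2 ⟨S, hS⟩, ← h₂.2 ⟨_, hS'⟩, (hmaps ⟨S, hS⟩ ⟨_, hS'⟩ rfl).2]
    exact SpinFrame.spinor_mul A _
  · rintro rfl
    refine ⟨by rw [h₁.1, h₂.1]; exact (linAct_spinorNormal A κ₁).symm, fun S S' hS => ?_⟩
    have outward_eq : D₂.outward S' = A * D₁.outward S := by
      refine SpinFrame.ext_of_basepoint_of_spinor ?_ ?_
      · rw [SpinFrame.basepoint_mul, D₁.basepoint_outward, D₂.basepoint_outward, hS]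
      · exact (h₂.2 S').trans ((SpinFrame.spinor_mul A _).trans (congrArg _ (h₁.2 S))).symm
    exact ⟨by rw [D₂.inward_eq, D₁.inward_eq, outward_eq, mul_assoc], outward_eq⟩

end LambdaLength

section RealSpinor

/-- A real vector, viewed as a spinor. -/
def realSpinor (v : Fin 2 → ℝ) : Fin 2 → ℂ := Complex.ofRealHom ∘ v

theorem realSpinor_injective : Function.Injective realSpinor :=
  Complex.ofReal_injective.comp_left

theorem realSpinor_ne_zero {v : Fin 2 → ℝ} (hv : v ≠ 0) : realSpinor v ≠ 0 := fun h =>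
  hv (realSpinor_injective (h.trans (by ext; simp [realSpinor])))

theorem spinorDet_realSpinor (v w : Fin 2 → ℝ) :
    spinorDet (realSpinor v) (realSpinor w) = spinorDet v w :=
  spinorDet_comp Complex.ofRealHom v w

theorem toSL2C_smul_realSpinor (A : SL2R) (v : Fin 2 → ℝ) :
    toSL2C A • realSpinor v = realSpinor (A • v) :=
  map_smul_comp Complex.ofRealHom A v

theorem map_starRingEnd_toSL2C (A : SL2R) :
    Matrix.SpecialLinearGroup.map (starRingEnd ℂ) (toSL2C A) = toSL2C A := by
  ext i j
  exact Complex.conj_ofReal _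

theorem mink_spinorNormal_realSpinor (v w : Fin 2 → ℝ) :
    mink (spinorNormal (realSpinor v)) (spinorNormal (realSpinor w)) = 2 * spinorDet v w ^ 2 := by
  rw [mink_spinorNormal, spinorDet_realSpinor, Complex.normSq_ofReal, sq]

end RealSpinor

section Plane

theorem planeMatrix_eq_spinorNormal_add (z : UpperHalfPlane) :
    planeMatrix z =
      (4 * z.im)⁻¹ • (spinorNormal ![(z : ℂ), 1] + spinorNormal ![star (z : ℂ), 1]) := by
  have hz := z.im_ne_zero
  ext i j
  fin_cases i <;> fin_cases j <;> apply Complex.ext <;>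
    simp [planeMatrix, spinorNormal_apply, sq] <;> field_simp <;> ring

theorem plane_smul (A : SL2R) (z : UpperHalfPlane) : plane (A • z) = toSL2C A • plane z := by
  set δ : ℂ := A.1 1 0 * (z : ℂ) + A.1 1 1
  have hδ : δ ≠ 0 := UpperHalfPlane.denom_ne_zero A z
  have smul_lift : toSL2C A • ![(z : ℂ), 1] = δ • ![((A • z : UpperHalfPlane) : ℂ), 1] := by
    ext i
    rw [specialLinearGroup_smul_apply, UpperHalfPlane.coe_specialLinearGroup_apply]
    fin_cases i
    · simpa [toSL2C] using (mul_div_cancel₀ _ hδ).symm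
    · simp [toSL2C, δ]
  have smul_conj : toSL2C A • ![star (z : ℂ), 1] =
      star δ • ![star ((A • z : UpperHalfPlane) : ℂ), 1] := by
    have conj_cons (x y : ℂ) : starRingEnd ℂ ∘ ![x, y] = ![star x, star y] := by
      ext i; fin_cases i <;> rfl
    have h := map_smul_comp (starRingEnd ℂ) (toSL2C A) ![(z : ℂ), 1]
    rw [map_starRingEnd_toSL2C, smul_lift] at h
    simpa [conj_cons] using h
  have im_eq : Complex.normSq δ * (A • z).im = z.im := by
    have h := spinorDet_specialLinearGroup_smul (toSL2C A) ![(z : ℂ), 1] ![star (z : ℂ), 1]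
    rw [smul_lift, smul_conj, spinorDet_smul_left, spinorDet_smul_right] at h
    have him := congrArg Complex.im h
    simp [spinorDet] at him
    rw [Complex.normSq_apply]
    linear_combination him / 2
  apply Subtype.ext
  change planeMatrix (A • z) = linAct (toSL2C A) (planeMatrix z)
  rw [planeMatrix_eq_spinorNormal_add, planeMatrix_eq_spinorNormal_add, linAct_smul, linAct_add,
    linAct_spinorNormal, linAct_spinorNormal, smul_lift, smul_conj, spinorNormal_smul,
    spinorNormal_smul, ← im_eq, Complex.star_def, Complex.normSq_conj, ← smul_add, smul_smul]
  congr 1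
  have := Complex.normSq_eq_zero.not.mpr hδ
  field_simp

theorem mink_plane (z w : UpperHalfPlane) :
    mink (plane z).1 (plane w).1 = Real.cosh (dist z w) := by
  change mink (planeMatrix z) (planeMatrix w) = _
  rw [UpperHalfPlane.cosh_dist, Complex.dist_eq, ← Complex.normSq_eq_norm_sq]
  simp only [planeMatrix_eq_spinorNormal_add, mink_smul_left, mink_smul_right, mink_add_left,
    mink_add_right, mink_spinorNormal]
  simp [spinorDet, Complex.normSq_apply]
  have := z.im_ne_zero
  have := w.im_ne_zero
  field_simp
  ring

theorem mink_plane_spinorNormal_realSpinor (z : UpperHalfPlane) (v : Fin 2 → ℝ) :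
    mink (plane z).1 (spinorNormal (realSpinor v)) =
      ((z.re * v 1 - v 0) ^ 2 + z.im ^ 2 * v 1 ^ 2) / z.im := by
  change mink (planeMatrix z) _ = _
  simp only [planeMatrix_eq_spinorNormal_add, mink_smul_left, mink_add_left, mink_spinorNormal]
  simp [spinorDet, Complex.normSq_apply, realSpinor]
  have := z.im_ne_zero
  field_simp
  ring

end Plane

section SpinorHorocycle

/-- The horocycle of a real spinor `v`: the intersection of the plane `y = 0` with the horosphere
of `v`. -/
def spinorHorocycle (v : Fin 2 → ℝ) : Set UpperHalfPlane :=
  plane ⁻¹' horosphere (spinorNormal (realSpinor v))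

theorem mem_spinorHorocycle_iff {z : UpperHalfPlane} {v : Fin 2 → ℝ} :
    z ∈ spinorHorocycle v ↔ (z.re * v 1 - v 0) ^ 2 + z.im ^ 2 * v 1 ^ 2 = z.im := by
  change mink (plane z).1 _ = 1 ↔ _
  rw [mink_plane_spinorNormal_realSpinor, div_eq_one_iff_eq z.im_ne_zero]

theorem smul_mem_spinorHorocycle_iff {A : SL2R} {z : UpperHalfPlane} {v : Fin 2 → ℝ} :
    A • z ∈ spinorHorocycle (A • v) ↔ z ∈ spinorHorocycle v := by
  rw [spinorHorocycle, Set.mem_preimage, plane_smul, ← toSL2C_smul_realSpinor,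
    smul_mem_horosphere_iff]
  rfl

theorem image_constSMul_spinorHorocycle (A : SL2R) (v : Fin 2 → ℝ) :
    IsometryEquiv.constSMul A '' spinorHorocycle v = spinorHorocycle (A • v) := by
  ext z
  rw [← IsometryEquiv.preimage_symm, IsometryEquiv.constSMul_symm, Set.mem_preimage,
    ← smul_mem_spinorHorocycle_iff (A := A)]
  simp

theorem plane_vadd_I (x : ℝ) : plane (x +ᵥ UpperHalfPlane.I) = SpinFrame.basepoint (upper x) := by
  apply Subtype.ext
  rw [SpinFrame.coe_basepoint, linAct_upper_one]
  change planeMatrix _ = _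
  ext i j
  fin_cases i <;> fin_cases j <;> simp [planeMatrix, add_comm, sq]

theorem exists_isHorosphericTriple_spinorHorocycle {v : Fin 2 → ℝ} (hv : v ≠ 0) :
    ∃ z₀ ∈ spinorHorocycle v, ∃ z₁ ∈ spinorHorocycle v, ∃ z₂ ∈ spinorHorocycle v,
      IsHorosphericTriple (plane z₀).1 (plane z₁) (plane z₂) := by
  obtain ⟨A, rfl⟩ := exists_smul_eq_of_ne_zero hv
  have hplane (x : ℝ) : plane (A • (x +ᵥ UpperHalfPlane.I)) =
      SpinFrame.basepoint (toSL2C A * upper x) := by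
    rw [plane_smul, plane_vadd_I, SpinFrame.basepoint_mul]
  have hmem (x : ℝ) : A • (x +ᵥ UpperHalfPlane.I) ∈ spinorHorocycle (A • ![1, 0]) := by
    rw [smul_mem_spinorHorocycle_iff, mem_spinorHorocycle_iff]
    simp
  refine ⟨_, hmem 0, _, hmem 1, _, hmem (-1), ?_⟩
  rw [hplane, hplane, hplane]
  exact_mod_cast isHorosphericTriple_basepoint_upper (toSL2C A)

theorem spinorDet_sq_eq_of_isometry {v w v' w' : Fin 2 → ℝ} (hv : v ≠ 0) (hw : w ≠ 0)
    (hv' : v' ≠ 0) (hw' : w' ≠ 0) (φ : UpperHalfPlane ≃ᵢ UpperHalfPlane)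
    (hφv : φ '' spinorHorocycle v = spinorHorocycle v')
    (hφw : φ '' spinorHorocycle w = spinorHorocycle w') :
    spinorDet v w ^ 2 = spinorDet v' w' ^ 2 := by
  have mink_map (z z' : UpperHalfPlane) :
      mink (plane (φ z)).1 (plane (φ z')).1 = mink (plane z).1 (plane z').1 := by
    rw [mink_plane, mink_plane, φ.isometry.dist_eq]
  have normal_eq {u u' : Fin 2 → ℝ} (hu : u ≠ 0) (hu' : u' ≠ 0)
      (h : φ '' spinorHorocycle u = spinorHorocycle u') : ∃ z₀ z₁ z₂,
      spinorNormal (realSpinor u) = (plane z₁).1 + (plane z₂).1 - (2 : ℝ) • (plane z₀).1 ∧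
      spinorNormal (realSpinor u') =
        (plane (φ z₁)).1 + (plane (φ z₂)).1 - (2 : ℝ) • (plane (φ z₀)).1 := by
    obtain ⟨z₀, h₀, z₁, h₁, z₂, h₂, triple⟩ := exists_isHorosphericTriple_spinorHorocycle hu
    have map_mem {z} (hz : z ∈ spinorHorocycle u) : φ z ∈ spinorHorocycle u' :=
      h ▸ Set.mem_image_of_mem φ hz
    refine ⟨z₀, z₁, z₂, triple.normal_eq
      (spinorNormal_mem_lightCone (realSpinor_ne_zero hu)) h₀ h₁ h₂,
      IsHorosphericTriple.normal_eq (spinorNormal_mem_lightCone (realSpinor_ne_zero hu'))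
        (map_mem h₀) (map_mem h₁) (map_mem h₂) ?_⟩
    simpa only [IsHorosphericTriple, mink_map] using triple
  obtain ⟨z₀, z₁, z₂, e, e'⟩ := normal_eq hv hv' hφv
  obtain ⟨w₀, w₁, w₂, f, f'⟩ := normal_eq hw hw' hφw
  apply mul_left_cancel₀ (two_ne_zero (α := ℝ))
  rw [← mink_spinorNormal_realSpinor, ← mink_spinorNormal_realSpinor, e, e', f, f']
  simp only [mink_add_left, mink_sub_left, mink_smul_left, mink_add_right, mink_sub_right,
    mink_smul_right, mink_map]

theorem spinorDet_eq_zero_of_spinorHorocycle_eq {v w : Fin 2 → ℝ} (hv : v ≠ 0) (hw : w ≠ 0)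
    (h : spinorHorocycle v = spinorHorocycle w) : spinorDet v w = 0 := by
  have hsq := spinorDet_sq_eq_of_isometry hv hv hv hw (IsometryEquiv.refl _)
    (Set.image_id _) ((Set.image_id _).trans h)
  rwa [spinorDet_self, zero_pow two_ne_zero, eq_comm, sq_eq_zero_iff] at hsq

end SpinorHorocycle

section IdealPoint

/-- The ideal point `v 0 / v 1` of a real spinor `v`, which is the centre of its horocycle. -/
def idealPoint (v : Fin 2 → ℝ) : OnePoint ℝ :=
  if v 1 = 0 then OnePoint.infty else ((v 0 / v 1 : ℝ) : OnePoint ℝ)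

theorem idealPoint_eq_infty (t : ℝ) : idealPoint ![t, 0] = OnePoint.infty :=
  if_pos rfl

theorem idealPoint_eq_coe (x : ℝ) {t : ℝ} (ht : t ≠ 0) :
    idealPoint ![x * t, t] = (x : OnePoint ℝ) := by
  simp [idealPoint, ht]

theorem exists_eq_infty_or_coe {v : Fin 2 → ℝ} (hv : v ≠ 0) :
    (∃ t, t ≠ 0 ∧ v = ![t, 0]) ∨ ∃ x t : ℝ, t ≠ 0 ∧ v = ![x * t, t] := by
  by_cases h : v 1 = 0
  · refine .inl ⟨v 0, fun h0 => hv ?_, ?_⟩ <;> ext i <;> fin_cases i <;> simp [*]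
  · exact .inr ⟨v 0 / v 1, v 1, h, by ext i; fin_cases i <;> simp [h]⟩

theorem spinorHorocycle_infty (t : ℝ) :
    spinorHorocycle ![t, 0] = horocycle OnePoint.infty (t ^ 2) := by
  ext z
  rw [mem_spinorHorocycle_iff]
  change _ ↔ z.im = t ^ 2
  simp [eq_comm]

theorem spinorHorocycle_coe (x : ℝ) {t : ℝ} (ht : t ≠ 0) :
    spinorHorocycle ![x * t, t] = horocycle (x : OnePoint ℝ) (t ^ 2)⁻¹ := by
  ext z
  rw [mem_spinorHorocycle_iff]
  change _ ↔ (z.re - x) ^ 2 + z.im ^ 2 = (t ^ 2)⁻¹ * z.im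
  rw [eq_inv_mul_iff_mul_eq₀ (pow_ne_zero 2 ht)]
  simp only [Matrix.cons_val_zero, Matrix.cons_val_one]
  ring_nf

theorem isHorocycle_iff_exists_spinorHorocycle_eq {p : OnePoint ℝ} {c : Set UpperHalfPlane} :
    IsHorocycle p c ↔ ∃ v, v ≠ 0 ∧ idealPoint v = p ∧ spinorHorocycle v = c := by
  constructor
  · rintro ⟨r, hr, rfl⟩
    have hsqrt := Real.sqrt_ne_zero'.mpr hr
    induction p using OnePoint.rec with
    | infty =>
      refine ⟨![√r, 0], fun h => hsqrt (congrFun h 0), idealPoint_eq_infty _, ?_⟩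
      rw [spinorHorocycle_infty, Real.sq_sqrt hr.le]
    | coe x =>
      have ht := inv_ne_zero hsqrt
      refine ⟨![x * (√r)⁻¹, (√r)⁻¹], fun h => ht (congrFun h 1), idealPoint_eq_coe x ht, ?_⟩
      rw [spinorHorocycle_coe x ht, inv_pow, inv_inv, Real.sq_sqrt hr.le]
  · rintro ⟨v, hv, rfl, rfl⟩
    rcases exists_eq_infty_or_coe hv with ⟨t, ht, rfl⟩ | ⟨x, t, ht, rfl⟩
    · exact ⟨t ^ 2, by positivity, by rw [idealPoint_eq_infty, spinorHorocycle_infty]⟩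
    · exact ⟨(t ^ 2)⁻¹, by positivity, by rw [idealPoint_eq_coe x ht, spinorHorocycle_coe x ht]⟩

theorem spinorDet_eq_zero_iff {v w : Fin 2 → ℝ} (hv : v ≠ 0) (hw : w ≠ 0) :
    spinorDet v w = 0 ↔ idealPoint v = idealPoint w := by
  rcases exists_eq_infty_or_coe hv with ⟨t, ht, rfl⟩ | ⟨x, t, ht, rfl⟩ <;>
  rcases exists_eq_infty_or_coe hw with ⟨s, hs, rfl⟩ | ⟨y, s, hs, rfl⟩ <;>
  simp only [spinorDet, idealPoint_eq_infty, idealPoint_eq_coe _ hs, idealPoint_eq_coe _ ht,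
    Matrix.cons_val_zero, Matrix.cons_val_one]
  · simp
  · simp [ht, hs]
  · simp [ht, hs]
  · rw [OnePoint.coe_eq_coe, show x * t * s - t * (y * s) = t * s * (x - y) by ring,
      mul_eq_zero_iff_left (mul_ne_zero ht hs), sub_eq_zero]

theorem cyclic_lt_iff_mul_pos (a b c : ℝ) :
    ((b < a ∧ c < b) ∨ (c < b ∧ a < c) ∨ (a < c ∧ b < a)) ↔
      0 < (a - b) * (b - c) * (a - c) := by
  rw [mul_pos_iff, mul_pos_iff, mul_neg_iff]
  grind

theorem cyclicTriple_idealPoint_iff {u v w : Fin 2 → ℝ} (hu : u ≠ 0) (hv : v ≠ 0) (hw : w ≠ 0) :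
    CyclicTriple (idealPoint u) (idealPoint v) (idealPoint w) ↔
      0 < spinorDet u v * spinorDet v w * spinorDet u w := by
  have height_infty : height OnePoint.infty = ⊤ := rfl
  have height_coe (x : ℝ) : height (x : OnePoint ℝ) = (x : WithTop ℝ) := rfl
  rcases exists_eq_infty_or_coe hu with ⟨t, ht, rfl⟩ | ⟨a, t, ht, rfl⟩ <;>
  rcases exists_eq_infty_or_coe hv with ⟨s, hs, rfl⟩ | ⟨b, s, hs, rfl⟩ <;>
  rcases exists_eq_infty_or_coe hw with ⟨r, hr, rfl⟩ | ⟨c, r, hr, rfl⟩ <;>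
  simp only [CyclicTriple, idealPoint_eq_infty, idealPoint_eq_coe _ ht, idealPoint_eq_coe _ hs,
    idealPoint_eq_coe _ hr, height_infty, height_coe, WithTop.coe_lt_coe, WithTop.coe_lt_top,
    not_top_lt, lt_irrefl, and_false, and_true, true_and, or_false, false_or, spinorDet,
    Matrix.cons_val_zero, Matrix.cons_val_one] <;>
  have hp : 0 < (t * s * r) ^ 2 := by positivity
  · simp
  · simp
  · simp
  · rw [← sub_pos, ← mul_pos_iff_of_pos_left hp]; ring_nf
  · simp
  · rw [← sub_pos, ← mul_pos_iff_of_pos_left hp]; ring_nf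
  · rw [← sub_pos, ← mul_pos_iff_of_pos_left hp]; ring_nf
  · rw [cyclic_lt_iff_mul_pos, ← mul_pos_iff_of_pos_left hp]; ring_nf

end IdealPoint

section Planar

theorem linAct_map_starRingEnd (A : SL2C) (X : Mat2) :
    linAct (Matrix.SpecialLinearGroup.map (starRingEnd ℂ) A) (X.map (starRingEnd ℂ)) =
      (linAct A X).map (starRingEnd ℂ) := by
  change A.1.map (starRingEnd ℂ) * X.map (starRingEnd ℂ) * (A.1.map (starRingEnd ℂ))ᴴ = _
  rw [linAct, Matrix.map_mul, Matrix.map_mul]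
  rfl

theorem SpinFrame.spinor_map_starRingEnd (W : SpinFrame) :
    SpinFrame.spinor (Matrix.SpecialLinearGroup.map (starRingEnd ℂ) W) =
      starRingEnd ℂ ∘ W.spinor := by
  rw [SpinFrame.spinor, SpinFrame.spinor, ← map_smul_comp]
  congr 1
  ext i; fin_cases i <;> simp

theorem planeMatrix_map_starRingEnd (z : UpperHalfPlane) :
    (planeMatrix z).map (starRingEnd ℂ) = planeMatrix z := by
  ext i j
  fin_cases i <;> fin_cases j <;> simp [planeMatrix]

theorem SpinFrame.frame_one_eq_eY_iff {W : SpinFrame} {z : UpperHalfPlane}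
    (hW : W.basepoint = plane z) : W.frame 1 = eY ↔ ∃ v, realSpinor v = W.spinor := by
  rw [frame_one, linAct_eY_eq_iff]
  constructor
  · intro hreal
    refine ⟨fun i => (W.spinor i).re, funext fun i => Complex.conj_eq_iff_re.mp ?_⟩
    conv_rhs => rw [← hreal]
    rw [spinor_map_starRingEnd, Function.comp_apply]
  · rintro ⟨v, hv⟩
    apply ext_of_basepoint_of_spinor
    · apply Subtype.ext
      have hmap := linAct_map_starRingEnd W 1
      rw [← coe_basepoint W, hW, Matrix.map_one _ (map_zero _) (map_one _)] at hmap
      rw [coe_basepoint, hmap, hW]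
      exact planeMatrix_map_starRingEnd z
    · rw [spinor_map_starRingEnd, ← hv]
      exact funext fun i => Complex.conj_ofReal (v i)

variable {D : SpinDecoratedHorosphere}

theorem isPlanarSpinDecoration_spinorHorocycle {v : Fin 2 → ℝ}
    (h : CorrespondsTo D (realSpinor v)) : IsPlanarSpinDecoration (spinorHorocycle v) D := by
  refine ⟨by rw [h.1]; rfl, fun z hz => ?_⟩
  have frame_one_outward : (D.outward ⟨plane z, hz⟩).frame 1 = eY :=
    (SpinFrame.frame_one_eq_eY_iff (D.basepoint_outward _)).mpr ⟨v, (h.2 _).symm⟩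
  exact ⟨by rw [D.inward_eq, SpinFrame.frame_one_mul_rotSecond_pi, frame_one_outward],
    frame_one_outward⟩

theorem exists_realSpinor_correspondsTo {c : Set UpperHalfPlane} (hc : c.Nonempty)
    (h : IsPlanarSpinDecoration c D) :
    ∃ v, v ≠ 0 ∧ spinorHorocycle v = c ∧ CorrespondsTo D (realSpinor v) := by
  obtain ⟨κ, hκ, hD⟩ := D.exists_spinor_correspondsTo
  obtain ⟨z, hz⟩ := hc
  rw [← h.1] at hz
  obtain ⟨v, hv⟩ := (SpinFrame.frame_one_eq_eY_iff (D.basepoint_outward _)).mp (h.2 z hz).2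
  obtain rfl : realSpinor v = κ := hv.trans (hD.2 _)
  refine ⟨v, ?_, by rw [← h.1, hD.1]; rfl, hD⟩
  rintro rfl
  exact hκ (by ext; simp [realSpinor])

end Planar

section Polygon

theorem idealPoint_neg (v : Fin 2 → ℝ) : idealPoint (-v) = idealPoint v := by
  simp [idealPoint]

theorem spinorHorocycle_neg (v : Fin 2 → ℝ) : spinorHorocycle (-v) = spinorHorocycle v := by
  ext z
  simp only [mem_spinorHorocycle_iff, Pi.neg_apply]
  ring_nf

variable {d : ℕ}

namespace PositiveMatrix

/-- Column `i` of a matrix, as a real spinor. -/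
def column (M : PositiveMatrix d) (i : Fin d) : Fin 2 → ℝ := fun k => M.1 k i

theorem spinorDet_column_pos (M : PositiveMatrix d) {i j : Fin d} (h : i < j) :
    0 < spinorDet (M.column i) (M.column j) := by
  have hM := M.2 i j h
  rw [Matrix.det_fin_two] at hM
  rwa [spinorDet, mul_comm (M.column i 1)]

theorem column_injective : Function.Injective (column : PositiveMatrix d → Fin d → Fin 2 → ℝ) :=
  fun _ _ h => Subtype.ext (funext fun k => funext fun i => congrFun (congrFun h i) k)

theorem eq_mul_iff {A : SL2R} {M N : PositiveMatrix d} :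
    N.1 = A.1 * M.1 ↔ ∀ i, N.column i = A • M.column i :=
  ⟨fun h i => funext fun k => congrFun (congrFun h k) i,
    fun h => funext fun k => funext fun i => congrFun (h i) k⟩

/-- The matrix with given columns. -/
def ofSpinors (v : Fin d → Fin 2 → ℝ) (h : ∀ i j, i < j → 0 < spinorDet (v i) (v j)) :
    PositiveMatrix d :=
  ⟨Matrix.of fun k i => v i k, fun i j hij => by
    rw [Matrix.det_fin_two]
    exact (h i j hij).trans_eq (congrArg _ (mul_comm _ _))⟩

theorem exists_eq_mul_of_spinorDet_eq [Nontrivial (Fin d)] {M N : PositiveMatrix d}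
    (h : ∀ i j, i < j →
      spinorDet (N.column i) (N.column j) = spinorDet (M.column i) (M.column j)) :
    ∃ A : SL2R, N.1 = A.1 * M.1 := by
  obtain ⟨a, b, hab⟩ := exists_pair_lt (Fin d)
  obtain ⟨A, hA⟩ := exists_eq_specialLinearGroup_smul (M.spinorDet_column_pos hab).ne'
    (w := N.column) fun i j => by
      rcases lt_trichotomy i j with hij | rfl | hij
      · exact h i j hij
      · rw [spinorDet_self, spinorDet_self]
      · rw [spinorDet_swap, h j i hij, ← spinorDet_swap]
  exact ⟨A, eq_mul_iff.mpr hA⟩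

variable [Nontrivial (Fin d)]

theorem column_ne_zero (M : PositiveMatrix d) (i : Fin d) : M.column i ≠ 0 := by
  intro h
  obtain ⟨j, hj⟩ := exists_ne i
  rcases hj.lt_or_gt with hji | hij
  · simpa [h, spinorDet] using M.spinorDet_column_pos hji
  · simpa [h, spinorDet] using M.spinorDet_column_pos hij

theorem inOrder_idealPoint_column (M : PositiveMatrix d) :
    InOrder fun i => idealPoint (M.column i) := by
  constructor
  · refine .of_lt_imp_ne fun i j hij h => (M.spinorDet_column_pos hij).ne' ?_
    exact (spinorDet_eq_zero_iff (M.column_ne_zero i) (M.column_ne_zero j)).mpr h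
  · intro i j k hij hjk
    rw [cyclicTriple_idealPoint_iff (M.column_ne_zero i) (M.column_ne_zero j) (M.column_ne_zero k)]
    exact mul_pos (mul_pos (M.spinorDet_column_pos hij) (M.spinorDet_column_pos hjk))
      (M.spinorDet_column_pos (hij.trans hjk))

/-- The spin-decorated horosphere of column `i`. -/
def decoration (M : PositiveMatrix d) (i : Fin d) : SpinDecoratedHorosphere :=
  (exists_correspondsTo (realSpinor_ne_zero (M.column_ne_zero i))).choose

theorem correspondsTo_decoration (M : PositiveMatrix d) (i : Fin d) :
    CorrespondsTo (M.decoration i) (realSpinor (M.column i)) :=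
  (exists_correspondsTo (realSpinor_ne_zero (M.column_ne_zero i))).choose_spec

theorem lambdaLength_decoration (M : PositiveMatrix d) (i j : Fin d) :
    lambdaLength (M.decoration i) (M.decoration j) =
      (spinorDet (M.column i) (M.column j) : ℝ) := by
  rw [lambdaLength_eq_spinorDet (M.correspondsTo_decoration i) (M.correspondsTo_decoration j),
    spinorDet_realSpinor]

/-- The spin-coherent ideal polygon whose vertices carry the spin-decorated horospheres of the
columns. -/
def gon (M : PositiveMatrix d) : SpinCoherentGon d where
  vertex i := idealPoint (M.column i)
  inOrder := M.inOrder_idealPoint_column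
  horocycle i := spinorHorocycle (M.column i)
  isHorocycle i :=
    isHorocycle_iff_exists_spinorHorocycle_eq.mpr ⟨_, M.column_ne_zero i, rfl, rfl⟩
  decoration := M.decoration
  planar i := isPlanarSpinDecoration_spinorHorocycle (M.correspondsTo_decoration i)
  coherent_lt i j h := ⟨_, M.spinorDet_column_pos h, M.lambdaLength_decoration i j⟩
  coherent_gt i j h := ⟨_, neg_neg_iff_pos.mpr (M.spinorDet_column_pos h), by
    rw [M.lambdaLength_decoration, spinorDet_swap]⟩

theorem gon_injective : Function.Injective (gon : PositiveMatrix d → SpinCoherentGon d) := by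
  refine fun M N h => column_injective (funext fun i => realSpinor_injective ?_)
  have decoration_eq : M.decoration i = N.decoration i := congrArg (·.decoration i) h
  exact (M.correspondsTo_decoration i).unique (decoration_eq ▸ N.correspondsTo_decoration i)

theorem gon_surjective : Function.Surjective (gon : PositiveMatrix d → SpinCoherentGon d) := by
  intro X
  choose u hu vertex_u horocycle_u using fun i =>
    isHorocycle_iff_exists_spinorHorocycle_eq.mp (X.isHorocycle i)
  have nonempty (i : Fin d) : (X.horocycle i).Nonempty := by
    obtain ⟨z, hz, -⟩ := exists_isHorosphericTriple_spinorHorocycle (hu i)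
    exact ⟨z, horocycle_u i ▸ hz⟩
  choose v hv horocycle_v hD using fun i =>
    exists_realSpinor_correspondsTo (nonempty i) (X.planar i)
  have vertex_v (i : Fin d) : idealPoint (v i) = X.vertex i := by
    rw [← vertex_u, ← spinorDet_eq_zero_iff (hv i) (hu i)]
    exact spinorDet_eq_zero_of_spinorHorocycle_eq (hv i) (hu i)
      ((horocycle_v i).trans (horocycle_u i).symm)
  have det_pos (i j : Fin d) (hij : i < j) : 0 < spinorDet (v i) (v j) := by
    obtain ⟨r, hr, h⟩ := X.coherent_lt i j hij
    rw [lambdaLength_eq_spinorDet (hD i) (hD j), spinorDet_realSpinor] at h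
    rwa [Complex.ofReal_injective h]
  have decoration_eq (i : Fin d) : (ofSpinors v det_pos).decoration i = X.decoration i :=
    (correspondsTo_decoration _ i).ext (hD i)
  refine ⟨ofSpinors v det_pos, ?_⟩
  obtain ⟨⟨p, _, c, _⟩, D, _, _, _⟩ := X
  simp only [gon, SpinCoherentGon.mk.injEq, DecoratedIdealGon.mk.injEq]
  exact ⟨⟨funext vertex_v, funext horocycle_v⟩, funext decoration_eq⟩

/-- The bijection from positive matrices to spin-coherent ideal polygons given by `gon`. -/
def gonEquiv : PositiveMatrix d ≃ SpinCoherentGon d :=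
  Equiv.ofBijective gon ⟨gon_injective, gon_surjective⟩

theorem mapsSpinGon_gon_iff {A : SL2R} {M N : PositiveMatrix d} :
    MapsSpinGon A M.gon N.gon ↔ N.1 = A.1 * M.1 := by
  refine Iff.trans (forall_congr' fun i => ?_) eq_mul_iff.symm
  rw [← realSpinor_injective.eq_iff, ← toSL2C_smul_realSpinor]
  exact (M.correspondsTo_decoration i).maps_iff (N.correspondsTo_decoration i)

theorem mapsGon_of_eq_mul {A : SL2R} {M N : PositiveMatrix d} (h : N.1 = A.1 * M.1) :
    MapsGon (IsometryEquiv.constSMul A) M.gon.toDecoratedIdealGon N.gon.toDecoratedIdealGon :=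
  fun i => (image_constSMul_spinorHorocycle A _).trans
    (congrArg spinorHorocycle (eq_mul_iff.mp h i).symm)

theorem exists_eq_mul_of_mapsGon {M N : PositiveMatrix d} {φ : UpperHalfPlane ≃ᵢ UpperHalfPlane}
    (h : MapsGon φ M.gon.toDecoratedIdealGon N.gon.toDecoratedIdealGon) :
    ∃ A : SL2R, N.1 = A.1 * M.1 := by
  refine exists_eq_mul_of_spinorDet_eq fun i j hij => ?_
  have sq_eq := spinorDet_sq_eq_of_isometry (M.column_ne_zero i) (M.column_ne_zero j)
    (N.column_ne_zero i) (N.column_ne_zero j) φ (h i) (h j)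
  exact ((pow_left_inj₀ (M.spinorDet_column_pos hij).le (N.spinorDet_column_pos hij).le
    two_ne_zero).mp sq_eq).symm

end PositiveMatrix

theorem spinorDet_pos_of_inOrder {v : Fin d → Fin 2 → ℝ} (hv : ∀ i, v i ≠ 0)
    (h : InOrder fun i => idealPoint (v i)) {a : Fin d}
    (ha : ∀ i, i ≠ a → a < i ∧ 0 < spinorDet (v a) (v i)) {i j : Fin d} (hij : i < j) :
    0 < spinorDet (v i) (v j) := by
  by_cases hi : i = a
  · exact hi ▸ (ha j (hi ▸ hij.ne')).2
  · obtain ⟨hai, pos_ai⟩ := ha i hi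
    obtain ⟨-, pos_aj⟩ := ha j (hai.trans hij).ne'
    have cyclic := (cyclicTriple_idealPoint_iff (hv a) (hv i) (hv j)).mp (h.2 a i j hai hij)
    exact (mul_pos_iff_of_pos_left pos_ai).mp ((mul_pos_iff_of_pos_right pos_aj).mp cyclic)

theorem exists_spinorDet_pos_of_ne {u v : Fin 2 → ℝ} (hu : u ≠ 0) (hv : v ≠ 0)
    (h : idealPoint u ≠ idealPoint v) : ∃ w, w ≠ 0 ∧ idealPoint w = idealPoint v ∧
      spinorHorocycle w = spinorHorocycle v ∧ 0 < spinorDet u w := by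
  have det_ne_zero : spinorDet u v ≠ 0 := mt (spinorDet_eq_zero_iff hu hv).mp h
  rcases det_ne_zero.lt_or_gt with hneg | hpos
  · exact ⟨-v, neg_ne_zero.mpr hv, idealPoint_neg v, spinorHorocycle_neg v,
      by rwa [spinorDet_neg_right, neg_pos]⟩
  · exact ⟨v, hv, rfl, rfl, hpos⟩

variable [Nontrivial (Fin d)]

theorem exists_gon_toDecoratedIdealGon_eq (P : DecoratedIdealGon d) :
    ∃ M : PositiveMatrix d, M.gon.toDecoratedIdealGon = P := by
  choose v hv vertex_v horocycle_v using fun i =>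
    isHorocycle_iff_exists_spinorHorocycle_eq.mp (P.isHorocycle i)
  obtain ⟨a, ha⟩ : ∃ a : Fin d, ∀ i, a ≤ i := Finite.exists_min id
  have normalized (i : Fin d) : ∃ w, w ≠ 0 ∧ idealPoint w = P.vertex i ∧
      spinorHorocycle w = P.horocycle i ∧ (i = a → w = v a) ∧
      (i ≠ a → 0 < spinorDet (v a) w) := by
    by_cases hi : i = a
    · exact ⟨v i, hv i, vertex_v i, horocycle_v i, fun _ => hi ▸ rfl, absurd hi⟩
    · obtain ⟨w, hw, vertex_w, horocycle_w, hpos⟩ :=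
        exists_spinorDet_pos_of_ne (hv a) (hv i) (by
          simpa only [vertex_v] using P.inOrder.1.ne (Ne.symm hi))
      exact ⟨w, hw, vertex_w.trans (vertex_v i), horocycle_w.trans (horocycle_v i),
        fun h => absurd h hi, fun _ => hpos⟩
  choose w hw vertex_w horocycle_w base det_base_pos using normalized
  have det_pos (i j : Fin d) (hij : i < j) : 0 < spinorDet (w i) (w j) := by
    refine spinorDet_pos_of_inOrder hw (by simpa only [vertex_w] using P.inOrder)
      (fun k hk => ⟨(ha k).lt_of_ne hk.symm, ?_⟩) hij
    rw [base a rfl]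
    exact det_base_pos k hk
  refine ⟨PositiveMatrix.ofSpinors w det_pos, ?_⟩
  obtain ⟨p, _, c, _⟩ := P
  simp only [PositiveMatrix.gon, DecoratedIdealGon.mk.injEq]
  exact ⟨funext vertex_w, funext horocycle_w⟩

/-- The map from spin isometry classes to isometry classes that forgets the spin decorations. -/
def forgetClass : SpinIsometryClass d → IsometryClass d :=
  Quotient.map SpinCoherentGon.toDecoratedIdealGon (by
    rintro X Y ⟨A, h⟩
    obtain ⟨M, rfl⟩ := PositiveMatrix.gon_surjective X
    obtain ⟨N, rfl⟩ := PositiveMatrix.gon_surjective Y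
    exact ⟨_, PositiveMatrix.mapsGon_of_eq_mul (PositiveMatrix.mapsSpinGon_gon_iff.mp h)⟩)

theorem forgetClass_injective : Function.Injective (forgetClass (d := d)) := by
  rintro ⟨X⟩ ⟨Y⟩ h
  obtain ⟨M, rfl⟩ := PositiveMatrix.gon_surjective X
  obtain ⟨N, rfl⟩ := PositiveMatrix.gon_surjective Y
  obtain ⟨φ, hφ⟩ := Quotient.exact h
  obtain ⟨A, hA⟩ := PositiveMatrix.exists_eq_mul_of_mapsGon hφ
  exact Quotient.sound ⟨A, PositiveMatrix.mapsSpinGon_gon_iff.mpr hA⟩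

theorem forgetClass_surjective : Function.Surjective (forgetClass (d := d)) := by
  rintro ⟨P⟩
  obtain ⟨M, rfl⟩ := exists_gon_toDecoratedIdealGon_eq P
  exact ⟨Quotient.mk _ M.gon, rfl⟩

end Polygon

end SpinPolygon

end

theorem mainTheorem11 (d : ℕ) (hd : 3 ≤ d) :
    ∃ (K : SpinPolygon.PositiveMatrix d ≃ SpinPolygon.SpinCoherentGon d)
      (Kbar : SpinPolygon.MatrixOrbit d ≃ SpinPolygon.SpinIsometryClass d)
      (Φ : SpinPolygon.SpinIsometryClass d ≃ SpinPolygon.IsometryClass d)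
      (Ψ : SpinPolygon.MatrixOrbit d ≃ SpinPolygon.IsometryClass d),
      (∀ M i, SpinPolygon.CorrespondsTo ((K M).decoration i) (M.spinor i)) ∧
      (∀ (A : SpinPolygon.SL2R) (M N : SpinPolygon.PositiveMatrix d),
        N.1 = A.1 * M.1 ↔ SpinPolygon.MapsSpinGon A (K M) (K N)) ∧
      (∀ M : SpinPolygon.PositiveMatrix d,
        Kbar (Quotient.mk (SpinPolygon.orbitSetoid d) M) =
          Quotient.mk (SpinPolygon.spinIsometrySetoid d) (K M)) ∧
      (∀ X : SpinPolygon.SpinCoherentGon d,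
        Φ (Quotient.mk (SpinPolygon.spinIsometrySetoid d) X) =
          Quotient.mk (SpinPolygon.isometrySetoid d) X.toDecoratedIdealGon) ∧
      (∀ M : SpinPolygon.PositiveMatrix d,
        Ψ (Quotient.mk (SpinPolygon.orbitSetoid d) M) =
          Quotient.mk (SpinPolygon.isometrySetoid d) (K M).toDecoratedIdealGon) := by
  have : Nontrivial (Fin d) := Fin.nontrivial_iff_two_le.mpr (by omega)
  let K : SpinPolygon.PositiveMatrix d ≃ SpinPolygon.SpinCoherentGon d :=
    SpinPolygon.PositiveMatrix.gonEquiv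
  have equivariant (A : SpinPolygon.SL2R) (M N : SpinPolygon.PositiveMatrix d) :
      N.1 = A.1 * M.1 ↔ SpinPolygon.MapsSpinGon A (K M) (K N) :=
    SpinPolygon.PositiveMatrix.mapsSpinGon_gon_iff.symm
  let Kbar : SpinPolygon.MatrixOrbit d ≃ SpinPolygon.SpinIsometryClass d :=
    Quotient.congr K fun M N => exists_congr fun A => equivariant A M N
  let Φ : SpinPolygon.SpinIsometryClass d ≃ SpinPolygon.IsometryClass d :=
    Equiv.ofBijective SpinPolygon.forgetClass
      ⟨SpinPolygon.forgetClass_injective, SpinPolygon.forgetClass_surjective⟩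
  exact ⟨K, Kbar, Φ, Kbar.trans Φ, SpinPolygon.PositiveMatrix.correspondsTo_decoration,
    equivariant, fun _ => rfl, fun _ => rfl, fun _ => rfl⟩
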